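/- Let $\mathbb{H}$ be the quaternions, $\mathbb{B}=\{q\in\mathbb{H}:|q|<1\}$, $\mathbb{S}=\{I\in\mathbb{H}: I^2=-1\}$ and, for $I\in\mathbb{S}$, $L_I=\mathbb{R}+\mathbb{R}I$; for $\Omega\subset\mathbb{H}$ write $\Omega_I=\Omega\cap L_I$. A function $f:\mathbb{B}\to\mathbb{H}$ is slice regular if for every $I\in\mathbb{S}$ the map $(x,y)\mapsto f(x+yI)$ is continuously differentiable on $\mathbb{B}_I$ and satisfies $\frac12\big(\frac{\partial}{\partial x}+I\frac{\partial}{\partial y}\big)f(x+yI)=0$ there. Then $f(q)=\sum_{n\ge0}q^na_n$ with $a_n=\frac1{n!}\frac{\partial^nf}{\partial x^n}(0)$, and the slice derivative is $\partial_cf=\frac{\partial f}{\partial x}$. For bounded $E\subset\mathbb{H}$ let $d_3(E)=\sup_{w_1,w_2,w_3\in E}\big(|w_2-w_1|\,|w_3-w_1|\,|w_3-w_2|\big)^{1/3}$; then $d_3(\mathbb{B})=\sqrt3$. Given $f$ slice regular on $\mathbb{B}$, let $a_N$ be its first non-vanishing coefficient and $b_n=a_na_N^{-1}|a_N|$ (all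 $b_n=0$ if $f\equiv0$). For $I\in\mathbb{S}$, $w_1,w_2,w_3\in\overline{\mathbb{B}}_I$ and $z\in\mathbb{B}$ put $$\hat g_{w_1,w_2,w_3}(z)=\sum_{n\ge0}z^n\sum_{k=0}^n\sum_{j=0}^k(w_2^j-w_1^j)(w_3^{k-j}-w_1^{k-j})(w_3^{n-k}-w_2^{n-k})\,b_jb_{k-j}b_{n-k}.$$ For $r\in(0,1)$ the slice $3$-diameter of $f(r\mathbb{B})$ is $$\hat d_3(f(r\mathbb{B}))=\sup_{I\in\mathbb{S}}\ \max_{w_1,w_2,w_3\in\overline{\mathbb{B}}_I}\ \max_{z\in r\overline{\mathbb{B}}_I}\big|\hat g_{w_1,w_2,w_3}(z)\big|^{1/3},$$ and $\hat d_3(f(\mathbb{B}))=\lim_{r\to1^-}\hat d_3(f(r\mathbb{B}))$. **Theorem (Landau–Toeplitz Theorem for the slice $3$-diameter).** Let $f$ be slice regular on $\mathbb{B}$ with $\hat d_3(f(\mathbb{B}))=d_3(\mathbb{B})=\sqrt3$. Then $$(1)\quad \hat d_3(f(r\mathbb{B}))\le d_3(r\mathbb{B})\ \text{ for every } r\in(0,1),\qquad\text{and}\qquad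 (2)\quad |\partial_cf(0)|\le1.$$ Moreover, equality holds in (1) for some $r\in(0,1)$ if and only if there are $a,b\in\mathbb{H}$ with $|b|=1$ such that $f(q)=a+qb$ for all $q\in\mathbb{B}$; and equality holds in (2) if and only if $f$ is of this form. The same statement holds if in the definition of $\hat d_3(f(r\mathbb{B}))$ the point $z$ ranges over the whole ball $r\overline{\mathbb{B}}$ instead of the disc $r\overline{\mathbb{B}}_I$ (consistently, in the hypothesis and in the conclusion). -/

import Mathlib

open scoped Quaternion Topology Nat

noncomputable section

namespace SliceRegular

/-- The unit `2`-sphere `𝕊 = {q ∈ ℍ | q² = -1}` of purely imaginary quaternions. -/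
def imagUnits : Set ℍ := {q | q ^ 2 = -1}

/-- The point `x + y I` of the plane `L_I`, where `z = x + i y`. -/
def slicePoint (I : ℍ) (z : ℂ) : ℍ := (z.re : ℍ) + (z.im : ℍ) * I

/-- The plane `L_I = ℝ + ℝ I`. -/
def slicePlane (I : ℍ) : Set ℍ := Set.range (slicePoint I)

/-- The closed disc of radius `r` centred at the origin of the plane `L_I`. -/
def closedDisc (I : ℍ) (r : ℝ) : Set ℍ := Metric.closedBall 0 r ∩ slicePlane I

/-- `f` is slice regular on the open ball `B(0, R)`: for every `I ∈ 𝕊` the restriction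
`(x, y) ↦ f (x + y I)` is continuously differentiable on the disc `x² + y² < R²` and satisfies
`½ (∂/∂x + I ∂/∂y) f (x + y I) = 0` there. Values of `f` outside the ball are irrelevant. -/
def IsSliceRegular (R : ℝ) (f : ℍ → ℍ) : Prop :=
  ∀ I ∈ imagUnits,
    ContDiffOn ℝ 1 (fun z : ℂ => f (slicePoint I z)) (Metric.ball 0 R) ∧
    ∀ z ∈ Metric.ball (0 : ℂ) R,
      (1 / 2 : ℝ) • (fderiv ℝ (fun w : ℂ => f (slicePoint I w)) z 1
        + I * fderiv ℝ (fun w : ℂ => f (slicePoint I w)) z Complex.I) = 0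

/-- The slice derivative `∂_c f (q) = ∂f/∂x (q)`, the derivative in the real direction. -/
def sliceDeriv (f : ℍ → ℍ) (q : ℍ) : ℍ := deriv (fun t : ℝ => f (q + (t : ℍ))) 0

/-- The coefficients `a_n = (1 / n!) ∂ⁿf/∂xⁿ (0)` of the expansion `f (q) = ∑ qⁿ a_n`. -/
def coeff (f : ℍ → ℍ) (n : ℕ) : ℍ :=
  ((n ! : ℝ)⁻¹) • iteratedDeriv n (fun x : ℝ => f (x : ℍ)) 0

/-- The index `N` of the first non-vanishing coefficient (and `0` if there is none). -/
def firstIndex (f : ℍ → ℍ) : ℕ := sInf {n | coeff f n ≠ 0}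

/-- The coefficients `b_n = a_n a_N⁻¹ |a_N|` of the normalised function; they are all zero when
all the `a_n` are. -/
def normCoeff (f : ℍ → ℍ) (n : ℕ) : ℍ :=
  coeff f n * (coeff f (firstIndex f))⁻¹ * ((‖coeff f (firstIndex f)‖ : ℝ) : ℍ)

/-- The function `ĝ_{w₁,w₂,w₃}(z)`. -/
def gHat (f : ℍ → ℍ) (w₁ w₂ w₃ z : ℍ) : ℍ :=
  ∑' n : ℕ, z ^ n * ∑ k ∈ Finset.range (n + 1), ∑ j ∈ Finset.range (k + 1),
    (w₂ ^ j - w₁ ^ j) * (w₃ ^ (k - j) - w₁ ^ (k - j)) * (w₃ ^ (n - k) - w₂ ^ (n - k))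
      * normCoeff f j * normCoeff f (k - j) * normCoeff f (n - k)

/-- The slice `3`-diameter of `f (r𝔹)`, the variable `z` of `ĝ` ranging over `Z I r` when
`w₁, w₂, w₃` range over the closed unit disc of `L_I`. -/
def sliceDiam3 (Z : ℍ → ℝ → Set ℍ) (f : ℍ → ℍ) (r : ℝ) : ℝ :=
  sSup {d : ℝ | ∃ I ∈ imagUnits, ∃ w₁ ∈ closedDisc I 1, ∃ w₂ ∈ closedDisc I 1,
    ∃ w₃ ∈ closedDisc I 1, ∃ z ∈ Z I r, d = ‖gHat f w₁ w₂ w₃ z‖ ^ (1 / 3 : ℝ)}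

/-- The `n`-diameter of a bounded set `E` of quaternions. -/
def nDiam (n : ℕ) (E : Set ℍ) : ℝ :=
  sSup {d : ℝ | ∃ w : Fin n → ℍ, (∀ i, w i ∈ E) ∧
    d = (∏ j, ∏ k ∈ Finset.Ioi j, ‖w k - w j‖) ^ (2 / ((n : ℝ) * ((n : ℝ) - 1)))}

/-- `f` is the affine function `q ↦ a + q b` on the open unit ball, for some `a, b ∈ ℍ` with
`|b| = 1`. -/
def IsUnitAffine (f : ℍ → ℍ) : Prop :=
  ∃ a b : ℍ, ‖b‖ = 1 ∧ ∀ q ∈ Metric.ball (0 : ℍ) 1, f q = a + q * b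

end SliceRegular

end

namespace SliceRegular

/-! Left multiplication by `L_I` makes `ℍ` a complex normed space in which slice regularity is
holomorphy on the slice. This yields the power series of `f`, whose coefficients are read off on the
real axis and so do not depend on `I`.

The series `ĝ` begins in degree 3 with coefficient `(w₂ - w₁)(w₃ - w₁)(w₃ - w₂) b₁³`. Fix the `w`'s
and a slice `L_J` containing `z` (in the ball version `J` need not be `I`), multiply `ĝ` on the
right by a unit `v` and project onto `L_J`: the result is `z³ u(z)` with `u` an ordinary holomorphic
function. The maximum principle on `|z| = ρ`, followed by `ρ → 1`, gives `|u| ≤ √3³`. Choosing `v`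
so that the projection attains `|ĝ|` gives (1). The value `u(0)` at the cube roots of unity gives
`√3 |a₁| r ≤ d̂₃(f(r𝔹))`, hence (2), and also equality in (1) when `|a₁| = 1`.

If `|a₁| < 1`, then `|u(0)| ≤ √3³ |a₁|³` uniformly in the `w`'s, and the Harnack-type bound
`norm_le_sub_of_norm_le` keeps `|u|` uniformly below `√3³` on `|z| ≤ r`. So (1) is strict even for
the supremum.

If `|a₁| = 1`, suppose `b₂, …, b_{m-1}` vanish. The coefficient of `ĝ` in degree `m + 2` then
involves only `b_m` and `b₁`, and by `norm_coeff_le_of_norm_le` its projection is bounded by a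
multiple of the defect of the Vandermonde product from `√3³`. Near an equilateral triangle this
defect is quadratic, so the first-order variation of that projection vanishes; this forces `b_m = 0`
(`eq_zero_of_vdm_bound`), and `f` is affine by induction. -/

/-! ### Imaginary units and the planes `L_I` -/

theorem re_eq_zero_of_mem_imagUnits {I : ℍ} (hI : I ∈ imagUnits) : I.re = 0 := by
  have h : I * I = -1 := by rw [← sq]; exact hI
  have h0 := congrArg QuaternionAlgebra.re h
  have h1 := congrArg QuaternionAlgebra.imI h
  have h2 := congrArg QuaternionAlgebra.imJ h
  have h3 := congrArg QuaternionAlgebra.imK h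
  simp only [Quaternion.re_mul, Quaternion.imI_mul, Quaternion.imJ_mul, Quaternion.imK_mul,
    Quaternion.re_neg, Quaternion.imI_neg, Quaternion.imJ_neg, Quaternion.imK_neg,
    Quaternion.re_one, Quaternion.imI_one, Quaternion.imJ_one, Quaternion.imK_one] at h0 h1 h2 h3
  by_contra hne
  have e1 : I.imI = 0 := by
    have : I.re * I.imI = 0 := by linarith
    exact (mul_eq_zero.mp this).resolve_left hne
  have e2 : I.imJ = 0 := by
    have : I.re * I.imJ = 0 := by linarith
    exact (mul_eq_zero.mp this).resolve_left hne
  have e3 : I.imK = 0 := by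
    have : I.re * I.imK = 0 := by linarith
    exact (mul_eq_zero.mp this).resolve_left hne
  rw [e1, e2, e3] at h0
  nlinarith [mul_self_nonneg I.re]

theorem sq_add_sq_of_mem_imagUnits {I : ℍ} (hI : I ∈ imagUnits) :
    I.imI ^ 2 + I.imJ ^ 2 + I.imK ^ 2 = 1 := by
  have h : I * I = -1 := by rw [← sq]; exact hI
  have h0 := congrArg QuaternionAlgebra.re h
  simp only [Quaternion.re_mul, Quaternion.re_neg, Quaternion.re_one,
    re_eq_zero_of_mem_imagUnits hI] at h0
  linarith

/-- The embedding of `ℂ` onto `L_I` as a homomorphism of real algebras. -/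
noncomputable def sliceHom (I : ℍ) (hI : I ∈ imagUnits) : ℂ →ₐ[ℝ] ℍ :=
  Complex.liftAux I (by rw [← sq]; exact hI)

theorem sliceHom_apply {I : ℍ} (hI : I ∈ imagUnits) (z : ℂ) : sliceHom I hI z = slicePoint I z := by
  rw [sliceHom, Complex.liftAux_apply, slicePoint, ← Quaternion.coe_mul_eq_smul]
  rfl

theorem norm_slicePoint {I : ℍ} (hI : I ∈ imagUnits) (z : ℂ) : ‖slicePoint I z‖ = ‖z‖ := by
  have h1 : ‖slicePoint I z‖ ^ 2 = ‖z‖ ^ 2 := by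
    rw [sq, ← Quaternion.normSq_eq_norm_mul_self, ← Complex.normSq_eq_norm_sq,
      Quaternion.normSq_def', Complex.normSq_apply]
    have := sq_add_sq_of_mem_imagUnits hI
    simp [slicePoint, re_eq_zero_of_mem_imagUnits hI]
    linear_combination z.im ^ 2 * this
  exact (sq_eq_sq₀ (norm_nonneg _) (norm_nonneg _)).mp h1

theorem slicePoint_ofReal (I : ℍ) (x : ℝ) : slicePoint I (x : ℂ) = (x : ℍ) := by
  simp [slicePoint]

theorem slicePoint_mul {I : ℍ} (hI : I ∈ imagUnits) (z w : ℂ) :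
    slicePoint I (z * w) = slicePoint I z * slicePoint I w := by
  simp only [← sliceHom_apply hI, map_mul]

theorem slicePoint_sub {I : ℍ} (hI : I ∈ imagUnits) (z w : ℂ) :
    slicePoint I (z - w) = slicePoint I z - slicePoint I w := by
  simp only [← sliceHom_apply hI, map_sub]

theorem slicePoint_pow {I : ℍ} (hI : I ∈ imagUnits) (z : ℂ) (n : ℕ) :
    slicePoint I (z ^ n) = slicePoint I z ^ n := by
  simp only [← sliceHom_apply hI, map_pow]

theorem mem_imagUnits_of_sq_add_sq {I : ℍ} (h0 : I.re = 0)
    (h1 : I.imI ^ 2 + I.imJ ^ 2 + I.imK ^ 2 = 1) : I ∈ imagUnits := by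
  change I ^ 2 = -1
  rw [sq]
  ext <;> simp [h0]
  · linarith
  all_goals ring

theorem exists_mem_imagUnits : ∃ I : ℍ, I ∈ imagUnits :=
  ⟨(⟨0, 1, 0, 0⟩ : ℍ), mem_imagUnits_of_sq_add_sq rfl (by norm_num)⟩

theorem exists_slicePoint_eq (q : ℍ) : ∃ I ∈ imagUnits, ∃ z : ℂ, q = slicePoint I z := by
  by_cases h : q.imI ^ 2 + q.imJ ^ 2 + q.imK ^ 2 = 0
  · obtain ⟨I, hI⟩ := exists_mem_imagUnits
    refine ⟨I, hI, (q.re : ℂ), ?_⟩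
    rw [slicePoint_ofReal]
    have h1 : q.imI = 0 := by nlinarith [sq_nonneg q.imI, sq_nonneg q.imJ, sq_nonneg q.imK]
    have h2 : q.imJ = 0 := by nlinarith [sq_nonneg q.imI, sq_nonneg q.imJ, sq_nonneg q.imK]
    have h3 : q.imK = 0 := by nlinarith [sq_nonneg q.imI, sq_nonneg q.imJ, sq_nonneg q.imK]
    ext <;> simp [h1, h2, h3]
  · have hpos : 0 < q.imI ^ 2 + q.imJ ^ 2 + q.imK ^ 2 := lt_of_le_of_ne (by positivity) (Ne.symm h)
    set s := √(q.imI ^ 2 + q.imJ ^ 2 + q.imK ^ 2) with hs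
    have hs0 : s ≠ 0 := (Real.sqrt_pos.mpr hpos).ne'
    have hss : s ^ 2 = q.imI ^ 2 + q.imJ ^ 2 + q.imK ^ 2 := Real.sq_sqrt hpos.le
    refine ⟨s⁻¹ • q.im, mem_imagUnits_of_sq_add_sq (by simp) ?_, ⟨q.re, s⟩, ?_⟩
    · simp
      field_simp
      linarith
    · ext <;> simp [slicePoint, hs0]

/-! ### Power series of slice regular functions -/

/-- The structure of complex normed space on `ℍ` given by left multiplication by elements of
`L_I`. -/
@[reducible]
noncomputable def leftNormedSpace (I : ℍ) (hI : I ∈ imagUnits) : NormedSpace ℂ ℍ :=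
  { Module.compHom ℍ (sliceHom I hI).toRingHom with
    norm_smul_le := fun z q => by
      change ‖sliceHom I hI z * q‖ ≤ _
      rw [norm_mul, sliceHom_apply, norm_slicePoint hI] }

/-- Convergence at a real point `r < 1` forces `‖A n‖ r ^ n → 0`, so the radius is at least `r`. -/
theorem hasFPowerSeriesOnBall_of_hasSum {𝕜 E : Type*} [RCLike 𝕜] [NormedAddCommGroup E]
    [NormedSpace 𝕜 E] {A : ℕ → E} {f : 𝕜 → E}
    (h : ∀ z : 𝕜, ‖z‖ < 1 → HasSum (fun n => z ^ n • A n) (f z)) :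
    HasFPowerSeriesOnBall f (fun n => ContinuousMultilinearMap.mkPiRing 𝕜 (Fin n) (A n)) 0 1 where
  r_le := by
    refine ENNReal.le_of_forall_nnreal_lt fun r hr => ?_
    refine FormalMultilinearSeries.le_radius_of_tendsto (l := 0) _ ?_
    have hr1 : ‖((r : ℝ) : 𝕜)‖ < 1 := by
      rw [RCLike.norm_ofReal, NNReal.abs_eq]
      exact_mod_cast hr
    have := (h _ hr1).summable.tendsto_atTop_zero.norm
    simp only [norm_zero, norm_smul, norm_pow, RCLike.norm_ofReal, NNReal.abs_eq] at this
    refine this.congr fun n => ?_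
    rw [ContinuousMultilinearMap.norm_mkPiRing, mul_comm]
  r_pos := one_pos
  hasSum := by
    intro y hy
    have hy1 : ‖y‖ < 1 := by simpa [Metric.mem_eball, ← ofReal_norm] using hy
    simpa [zero_add] using h y hy1

theorem iteratedDeriv_of_hasSum {𝕜 E : Type*} [RCLike 𝕜] [NormedAddCommGroup E]
    [NormedSpace 𝕜 E] [CompleteSpace E] {A : ℕ → E} {f : 𝕜 → E}
    (h : ∀ z : 𝕜, ‖z‖ < 1 → HasSum (fun n => z ^ n • A n) (f z)) (n : ℕ) :
    iteratedDeriv n f 0 = n ! • A n := by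
  rw [iteratedDeriv_eq_iteratedFDeriv,
    ← (hasFPowerSeriesOnBall_of_hasSum h).factorial_smul (1 : 𝕜) n]
  simp

theorem summable_norm_mul_pow_of_hasSum {𝕜 E : Type*} [RCLike 𝕜] [NormedAddCommGroup E]
    [NormedSpace 𝕜 E] {A : ℕ → E} {f : 𝕜 → E}
    (h : ∀ z : 𝕜, ‖z‖ < 1 → HasSum (fun n => z ^ n • A n) (f z)) {r : ℝ} (hr : 0 ≤ r)
    (hr1 : r < 1) : Summable fun n => ‖A n‖ * r ^ n := by
  lift r to NNReal using hr
  have := FormalMultilinearSeries.summable_norm_mul_pow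
    (fun n => ContinuousMultilinearMap.mkPiRing 𝕜 (Fin n) (A n)) (r := r)
    (lt_of_lt_of_le (by exact_mod_cast hr1) (hasFPowerSeriesOnBall_of_hasSum h).r_le)
  simpa [ContinuousMultilinearMap.norm_mkPiRing] using this

theorem exists_hasSum_slice {f : ℍ → ℍ} (hf : IsSliceRegular 1 f) {I : ℍ} (hI : I ∈ imagUnits) :
    ∃ A : ℕ → ℍ, ∀ z : ℂ, ‖z‖ < 1 →
      HasSum (fun n => slicePoint I z ^ n * A n) (f (slicePoint I z)) := by
  let _ := leftNormedSpace I hI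
  have hsmul : ∀ (z : ℂ) (q : ℍ), z • q = slicePoint I z * q := fun z q => by
    rw [← sliceHom_apply hI]; rfl
  have : IsScalarTower ℝ ℂ ℍ := ⟨fun x z q => by
    rw [hsmul, hsmul, ← sliceHom_apply hI, ← sliceHom_apply hI, map_smul, smul_mul_assoc]⟩
  obtain ⟨h1, h2⟩ := hf I hI
  have hd : DifferentiableOn ℂ (fun z : ℂ => f (slicePoint I z)) (Metric.ball 0 1) := by
    intro z hz
    have hr := ((h1.differentiableOn one_ne_zero).differentiableAt
      (Metric.isOpen_ball.mem_nhds hz)).hasFDerivAt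
    have := h2 z hz
    rw [smul_eq_zero_iff_right (by norm_num)] at this
    have hI2 : I * I = -1 := by rw [← sq]; exact hI
    set d := fderiv ℝ (fun w : ℂ => f (slicePoint I w)) z
    -- The Cauchy–Riemann equation says exactly that the real differential is linear over `ℂ` acting
    -- through `L_I` on the left.
    have hdI : d Complex.I = I * d 1 := by
      rw [eq_neg_of_add_eq_zero_left this, mul_neg, ← mul_assoc, hI2, neg_mul, one_mul, neg_neg]
    refine (hasFDerivAt_of_restrictScalars ℝ hr
      (f' := ContinuousLinearMap.toSpanSingleton ℂ (d 1)) ?_).differentiableAt.differentiableWithinAt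
    refine ContinuousLinearMap.ext fun w => ?_
    have hw : w = w.re • (1 : ℂ) + w.im • Complex.I := by
      simp [Complex.re_add_im]
    conv_rhs => rw [hw, map_add, map_smul, map_smul, hdI]
    rw [ContinuousLinearMap.coe_restrictScalars', ContinuousLinearMap.toSpanSingleton_apply, hsmul,
      slicePoint, add_mul, Quaternion.coe_mul_eq_smul, Quaternion.coe_mul_eq_smul, smul_mul_assoc]
  refine ⟨fun n => (n ! : ℂ)⁻¹ • iteratedDeriv n (fun z : ℂ => f (slicePoint I z)) 0, fun z hz => ?_⟩
  have := Complex.hasSum_taylorSeries_on_ball hd (z := z) (by simpa using hz)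
  refine this.congr_fun ?_
  intro n
  rw [sub_zero, smul_comm, hsmul (z ^ n), slicePoint_pow hI]

theorem coeff_eq_of_hasSum {f : ℍ → ℍ} {A : ℕ → ℍ}
    (h : ∀ x : ℝ, ‖x‖ < 1 → HasSum (fun n => (x : ℍ) ^ n * A n) (f x)) (n : ℕ) :
    coeff f n = A n := by
  rw [coeff, iteratedDeriv_of_hasSum (A := A), ← Nat.cast_smul_eq_nsmul ℝ, smul_smul,
    inv_mul_cancel₀ (by positivity), one_smul]
  intro x hx
  refine (h x hx).congr_fun fun n => ?_
  rw [← Quaternion.coe_pow, Quaternion.coe_mul_eq_smul]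

/-- The coefficients found on `L_I` could depend on `I`; the real axis, common to all slices,
determines them. -/
theorem hasSum_coeff_slice {f : ℍ → ℍ} (hf : IsSliceRegular 1 f) {I : ℍ} (hI : I ∈ imagUnits)
    {z : ℂ} (hz : ‖z‖ < 1) :
    HasSum (fun n => slicePoint I z ^ n * coeff f n) (f (slicePoint I z)) := by
  obtain ⟨A, hA⟩ := exists_hasSum_slice hf hI
  have : coeff f = A := funext fun n => coeff_eq_of_hasSum (fun x hx => by
    have := hA (x : ℂ) (by simpa using hx)
    rwa [slicePoint_ofReal] at this) n
  rw [this]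
  exact hA z hz

theorem hasSum_coeff_ofReal {f : ℍ → ℍ} (hf : IsSliceRegular 1 f) (x : ℝ) (hx : ‖x‖ < 1) :
    HasSum (fun n => x ^ n • coeff f n) (f (x : ℍ)) := by
  obtain ⟨I, hI⟩ := exists_mem_imagUnits
  have := hasSum_coeff_slice hf hI (z := (x : ℂ)) (by simpa using hx)
  rw [slicePoint_ofReal] at this
  refine this.congr_fun fun n => ?_
  rw [← Quaternion.coe_pow, Quaternion.coe_mul_eq_smul]

theorem summable_norm_coeff {f : ℍ → ℍ} (hf : IsSliceRegular 1 f) {r : ℝ} (hr : 0 ≤ r)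
    (hr1 : r < 1) : Summable fun n => ‖coeff f n‖ * r ^ n :=
  summable_norm_mul_pow_of_hasSum (𝕜 := ℝ) (f := fun x : ℝ => f (x : ℍ))
    (hasSum_coeff_ofReal hf) hr hr1

theorem sliceDeriv_zero (f : ℍ → ℍ) : sliceDeriv f 0 = coeff f 1 := by
  simp [sliceDeriv, coeff, iteratedDeriv_one]

/-- The factor `a_N⁻¹ |a_N|` has norm one, unless all coefficients vanish. -/
theorem norm_normCoeff (f : ℍ → ℍ) (n : ℕ) : ‖normCoeff f n‖ = ‖coeff f n‖ := by
  rw [normCoeff, norm_mul, norm_mul, norm_inv, Quaternion.norm_coe, norm_norm]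
  by_cases h : ∃ m, coeff f m ≠ 0
  · have : coeff f (firstIndex f) ≠ 0 := Nat.sInf_mem (s := {n | coeff f n ≠ 0}) h
    rw [inv_mul_cancel_right₀ (norm_ne_zero_iff.mpr this)]
  · push Not at h
    simp [h]

theorem eq_affine_of_coeff_eq_zero {f : ℍ → ℍ} (hf : IsSliceRegular 1 f)
    (h : ∀ n, 2 ≤ n → coeff f n = 0) (q : ℍ) (hq : ‖q‖ < 1) :
    f q = coeff f 0 + q * coeff f 1 := by
  obtain ⟨I, hI, z, rfl⟩ := exists_slicePoint_eq q
  rw [norm_slicePoint hI] at hq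
  refine (hasSum_coeff_slice hf hI hq).unique ?_
  have := hasSum_sum_of_ne_finset_zero (f := fun n => slicePoint I z ^ n * coeff f n)
    (s := Finset.range 2) (L := .unconditional ℕ) fun n hn => by
      rw [h n (by simpa [Nat.succ_le_iff] using hn), mul_zero]
  simpa only [Finset.sum_range_succ, Finset.sum_range_zero, zero_add, pow_zero, pow_one,
    one_mul] using this

theorem coeff_one_of_affine {f : ℍ → ℍ} {a b : ℍ}
    (h : ∀ q ∈ Metric.ball (0 : ℍ) 1, f q = a + q * b) : sliceDeriv f 0 = b := by
  have hev : (fun t : ℝ => f (0 + (t : ℍ))) =ᶠ[𝓝 0] fun t : ℝ => a + t • b := by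
    filter_upwards [Metric.ball_mem_nhds (0 : ℝ) one_pos] with t ht
    rw [zero_add, h _ (by simpa using ht), Quaternion.coe_mul_eq_smul]
  rw [sliceDeriv, hev.deriv_eq]
  have : HasDerivAt (fun t : ℝ => a + t • b) ((1 : ℝ) • b) 0 :=
    ((hasDerivAt_id (0 : ℝ)).smul_const b).const_add a
  simpa using this.deriv

/-! ### Bounded holomorphic functions on the unit disc -/

theorem differentiableOn_of_hasSum {c : ℕ → ℂ} {u : ℂ → ℂ}
    (h : ∀ z : ℂ, ‖z‖ < 1 → HasSum (fun n => z ^ n • c n) (u z)) :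
    DifferentiableOn ℂ u (Metric.ball 0 1) := by
  refine (hasFPowerSeriesOnBall_of_hasSum h).differentiableOn.mono fun z hz => ?_
  simpa [Metric.mem_eball, ← ofReal_norm] using hz

theorem apply_zero_of_hasSum {E : Type*} [NormedAddCommGroup E] [NormedSpace ℂ E] {c : ℕ → E}
    {u : ℂ → E} (h : ∀ z : ℂ, ‖z‖ < 1 → HasSum (fun n => z ^ n • c n) (u z)) : u 0 = c 0 := by
  refine (h 0 (by simp)).unique ?_
  convert hasSum_single (f := fun n => (0 : ℂ) ^ n • c n) 0 fun n hn => by simp [hn] using 1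
  simp

/-- The Taylor coefficients of a holomorphic function bounded by `M` are controlled by the defect
`M - ‖c 0‖` of its value at the origin. -/
theorem norm_coeff_le_of_norm_le {c : ℕ → ℂ} {u : ℂ → ℂ} {M δ : ℝ}
    (h : ∀ z : ℂ, ‖z‖ < 1 → HasSum (fun n => z ^ n • c n) (u z))
    (hu : ∀ z : ℂ, ‖z‖ < 1 → ‖u z‖ ≤ M) (hδ : 0 < δ) (hM : M - ‖c 0‖ ≤ δ) {k : ℕ} (hk : 1 ≤ k) :
    ‖c k‖ ≤ 2 ^ (k + 1) * δ := by
  -- The rotation makes `e * c 0` real and nonnegative, so `e * u - e * c 0` has real part at most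
  -- `M - ‖c 0‖ ≤ δ`.
  obtain ⟨e, he1, he⟩ : ∃ e : ℂ, ‖e‖ = 1 ∧ e * c 0 = ‖c 0‖ := by
    by_cases h0 : c 0 = 0
    · exact ⟨1, by simp, by simp [h0]⟩
    · have hn : ‖c 0‖ ≠ 0 := norm_ne_zero_iff.mpr h0
      refine ⟨‖c 0‖ / c 0, ?_, ?_⟩
      · rw [norm_div, Complex.norm_real, norm_norm, div_self hn]
      · field_simp
  have hd := differentiableOn_of_hasSum h
  have h0 := apply_zero_of_hasSum h
  set g : ℂ → ℂ := fun z => e * u z - e * c 0 with hg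
  have hgd : DifferentiableOn ℂ g (Metric.ball 0 1) := (hd.const_mul e).sub_const _
  have hg1 : Set.MapsTo g (Metric.ball 0 1) {z | z.re ≤ δ} := by
    intro z hz
    have h1 : (e * u z).re ≤ M := by
      refine (Complex.re_le_norm _).trans ?_
      rw [norm_mul, he1, one_mul]
      exact hu z (by simpa using hz)
    change (g z).re ≤ δ
    rw [hg, he, Complex.sub_re, Complex.ofReal_re]
    linarith
  -- Borel–Carathéodory at radius `1/2` gives `2δ`; Cauchy's estimate on that circle contributes the
  -- remaining `2 ^ k`.
  have hbound : ∀ z ∈ Metric.sphere (0 : ℂ) (1 / 2), ‖g z‖ ≤ 2 * δ := by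
    intro z hz
    have hz' : ‖z‖ = 1 / 2 := by simpa using hz
    have := Complex.borelCaratheodory_zero hδ hgd hg1 one_pos (z := z)
      (by simp [hz']; norm_num) (by simp [hg, h0])
    rw [hz'] at this
    refine this.trans (le_of_eq ?_)
    ring
  have hgs : ∀ z : ℂ, ‖z‖ < 1 →
      HasSum (fun n => z ^ n • (e * c n - if n = 0 then e * c 0 else 0)) (g z) := by
    intro z hz
    have h1 := (h z hz).mul_left e
    have h2 := hasSum_ite_eq 0 (e * c 0)
    refine (h1.sub h2).congr_fun fun n => ?_
    by_cases hn : n = 0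
    · simp [hn]
    · simp [hn]; ring
  have hi := iteratedDeriv_of_hasSum hgs k
  have hgdc : DiffContOnCl ℂ g (Metric.ball 0 (1 / 2)) :=
    (hgd.mono (Metric.closedBall_subset_ball (by norm_num))).diffContOnCl_ball subset_rfl
  have hc := Complex.norm_iteratedDeriv_le_of_forall_mem_sphere_norm_le k (by norm_num) hgdc hbound
  rw [hi, if_neg (by lia), sub_zero, ← Nat.cast_smul_eq_nsmul ℝ, norm_smul, norm_mul, he1, one_mul,
    Real.norm_natCast, mul_div_assoc] at hc
  have := le_of_mul_le_mul_left hc (by positivity)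
  refine this.trans (le_of_eq ?_)
  rw [one_div, inv_pow, div_inv_eq_mul]
  ring

/-- A holomorphic function bounded by `M` stays away from `M` on smaller discs, quantitatively in
terms of its value at the origin. -/
theorem norm_le_sub_of_norm_le {c : ℕ → ℂ} {u : ℂ → ℂ} {M : ℝ}
    (h : ∀ z : ℂ, ‖z‖ < 1 → HasSum (fun n => z ^ n • c n) (u z))
    (hu : ∀ z : ℂ, ‖z‖ < 1 → ‖u z‖ ≤ M) (h0 : ‖c 0‖ < M) {r : ℝ} (hr : r < 1) {z : ℂ}
    (hz : ‖z‖ ≤ r) : ‖u z‖ ≤ M - (M - ‖c 0‖) * (1 - r) / (1 + r) := by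
  have hd := differentiableOn_of_hasSum h
  have hu0 := apply_zero_of_hasSum h
  have hz1 : ‖z‖ < 1 := hz.trans_lt hr
  have hr0 : 0 ≤ r := (norm_nonneg z).trans hz
  have hM : 0 < M := (norm_nonneg _).trans_lt h0
  have hlt : ∀ w : ℂ, ‖w‖ < 1 → ‖u w‖ < M := by
    intro w hw
    refine lt_of_le_of_ne (hu w hw) fun heq => ?_
    have hmax : IsMaxOn (norm ∘ u) (Metric.ball 0 1) w := fun x hx => by
      change ‖u x‖ ≤ ‖u w‖
      rw [heq]; exact hu x (by simpa using hx)
    have := Complex.eqOn_of_isPreconnected_of_isMaxOn_norm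
      (convex_ball (0 : ℂ) 1).isPreconnected Metric.isOpen_ball hd (by simpa using hw) hmax
      (Metric.mem_ball_self one_pos)
    rw [hu0] at this
    simp only [Function.const_apply] at this
    rw [this, heq] at h0
    exact lt_irrefl _ h0
  obtain ⟨e, he1, he⟩ : ∃ e : ℂ, ‖e‖ = 1 ∧ e * u z = ‖u z‖ := by
    by_cases h0 : u z = 0
    · exact ⟨1, by simp, by simp [h0]⟩
    · have hn : ‖u z‖ ≠ 0 := norm_ne_zero_iff.mpr h0
      refine ⟨‖u z‖ / u z, ?_, ?_⟩
      · rw [norm_div, Complex.norm_real, norm_norm, div_self hn]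
      · field_simp
  have hre : ∀ w : ℂ, ‖w‖ < 1 → 0 < ((M : ℂ) - e * u w).re := by
    intro w hw
    have : (e * u w).re ≤ ‖u w‖ := by
      refine (Complex.re_le_norm _).trans ?_
      rw [norm_mul, he1, one_mul]
    rw [Complex.sub_re, Complex.ofReal_re]
    linarith [hlt w hw]
  have hne : ∀ w : ℂ, ‖w‖ < 1 → (M : ℂ) - e * u w ≠ 0 := fun w hw h' => by
    have := hre w hw
    simp [h'] at this
  -- The real part of `p` is negative, so Borel–Carathéodory applies with every bound `ε > 0`;
  -- letting `ε → 0` gives a Harnack-type inequality for `p`.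
  set p : ℂ → ℂ := fun w => -((M : ℂ) - e * u w)⁻¹ with hp
  have hpd : DifferentiableOn ℂ p (Metric.ball 0 1) :=
    (((hd.const_mul e).const_sub _).inv fun w hw => hne w (by simpa using hw)).neg
  have key : ‖p z‖ ≤ ‖p 0‖ * (1 + r) / (1 - r) := by
    have hε : ∀ ε : ℝ, 0 < ε → ‖p z‖ ≤ 2 * ε * ‖z‖ / (1 - ‖z‖) + ‖p 0‖ * (1 + ‖z‖) / (1 - ‖z‖) := by
      intro ε hε
      refine Complex.borelCaratheodory hε hpd (fun w hw => ?_) one_pos (by simpa using hz1)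
      change (p w).re ≤ ε
      have := hre w (by simpa using hw)
      rw [hp, Complex.neg_re, Complex.inv_re]
      have : 0 ≤ ((M : ℂ) - e * u w).re / Complex.normSq ((M : ℂ) - e * u w) :=
        div_nonneg this.le (Complex.normSq_nonneg _)
      linarith
    have hlim : Filter.Tendsto
        (fun ε : ℝ => 2 * ε * ‖z‖ / (1 - ‖z‖) + ‖p 0‖ * (1 + ‖z‖) / (1 - ‖z‖)) (𝓝[>] 0)
        (𝓝 (2 * 0 * ‖z‖ / (1 - ‖z‖) + ‖p 0‖ * (1 + ‖z‖) / (1 - ‖z‖))) := by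
      refine Filter.Tendsto.mono_left ?_ nhdsWithin_le_nhds
      exact Continuous.tendsto (by fun_prop) 0
    have := ge_of_tendsto hlim (by filter_upwards [self_mem_nhdsWithin] with ε he using hε ε he)
    refine this.trans ?_
    rw [mul_zero, zero_mul, zero_div, zero_add]
    have : 0 < 1 - r := by linarith
    gcongr
  have e1 : ‖p z‖ = (M - ‖u z‖)⁻¹ := by
    rw [hp, norm_neg, norm_inv, he, ← Complex.ofReal_sub, Complex.norm_real,
      Real.norm_of_nonneg (by linarith [hlt z hz1])]
  have e2 : ‖p 0‖ ≤ (M - ‖c 0‖)⁻¹ := by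
    rw [hp, norm_neg, norm_inv, hu0]
    refine inv_anti₀ (by linarith) ?_
    have := norm_sub_norm_le (M : ℂ) (e * c 0)
    rwa [Complex.norm_real, Real.norm_of_nonneg hM.le, norm_mul, he1, one_mul] at this
  have hA : 0 < M - ‖u z‖ := by linarith [hlt z hz1]
  have hB : 0 < M - ‖c 0‖ := by linarith
  have hC : 0 < 1 - r := by linarith
  have : (M - ‖u z‖)⁻¹ ≤ (M - ‖c 0‖)⁻¹ * (1 + r) / (1 - r) := by
    rw [← e1]
    refine key.trans ?_
    gcongr
  rw [inv_mul_eq_div, div_div, inv_le_comm₀ hA (by positivity), inv_div] at this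
  linarith

theorem norm_mul_le_of_sphere {c : ℕ → ℂ} {u : ℂ → ℂ} {K ρ : ℝ}
    (h : ∀ z : ℂ, ‖z‖ < 1 → HasSum (fun n => z ^ n • c n) (u z)) (hρ : 0 < ρ) (hρ1 : ρ < 1)
    (hK : ∀ z : ℂ, ‖z‖ = ρ → ‖z ^ 3 * u z‖ ≤ K) {z : ℂ} (hz : ‖z‖ ≤ ρ) : ‖u z‖ ≤ K / ρ ^ 3 := by
  have hd := differentiableOn_of_hasSum h
  have hdc : DiffContOnCl ℂ u (Metric.ball 0 ρ) :=
    (hd.mono (Metric.closedBall_subset_ball hρ1)).diffContOnCl_ball subset_rfl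
  refine Complex.norm_le_of_forall_mem_frontier_norm_le Metric.isBounded_ball hdc (fun w hw => ?_)
    (by rw [closure_ball _ hρ.ne']; simpa using hz)
  rw [frontier_ball _ hρ.ne'] at hw
  have hw' : ‖w‖ = ρ := by simpa using hw
  rw [le_div_iff₀ (by positivity), mul_comm]
  simpa [hw'] using hK w hw'

/-! ### Triangles in a disc and the Vandermonde product -/

/-- The squared sides and `‖x + y + z‖ ^ 2` add up to `3 (‖x‖² + ‖y‖² + ‖z‖²)`; AM–GM then bounds
the product of the sides. -/
theorem norm_sub_mul_norm_sub_mul_norm_sub_le {E : Type*} [NormedAddCommGroup E]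
    [InnerProductSpace ℝ E] {x y z : E} {r : ℝ} (hx : ‖x‖ ≤ r) (hy : ‖y‖ ≤ r) (hz : ‖z‖ ≤ r) :
    ‖y - x‖ * ‖z - x‖ * ‖z - y‖ ≤ (√3 * r) ^ 3 := by
  have hr : 0 ≤ r := (norm_nonneg x).trans hx
  have h3 : √3 ^ 2 = (3 : ℝ) := Real.sq_sqrt (by norm_num)
  have hs : ‖y - x‖ ^ 2 + ‖z - x‖ ^ 2 + ‖z - y‖ ^ 2 ≤ 9 * r ^ 2 := by
    have e : ‖y - x‖ ^ 2 + ‖z - x‖ ^ 2 + ‖z - y‖ ^ 2 + ‖x + y + z‖ ^ 2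
        = 3 * (‖x‖ ^ 2 + ‖y‖ ^ 2 + ‖z‖ ^ 2) := by
      rw [norm_sub_sq_real, norm_sub_sq_real, norm_sub_sq_real, norm_add_sq_real, norm_add_sq_real,
        inner_add_left, real_inner_comm x y, real_inner_comm x z, real_inner_comm y z]
      ring
    have a1 : ‖x‖ ^ 2 ≤ r ^ 2 := by gcongr
    have a2 : ‖y‖ ^ 2 ≤ r ^ 2 := by gcongr
    have a3 : ‖z‖ ^ 2 ≤ r ^ 2 := by gcongr
    nlinarith [sq_nonneg ‖x + y + z‖]
  set a := ‖y - x‖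
  set b := ‖z - x‖
  set c := ‖z - y‖
  have ha : 0 ≤ a := norm_nonneg _
  have hb : 0 ≤ b := norm_nonneg _
  have hc : 0 ≤ c := norm_nonneg _
  refine le_of_sq_le_sq ?_ (by positivity)
  have amgm : 27 * (a ^ 2 * b ^ 2 * c ^ 2) ≤ (a ^ 2 + b ^ 2 + c ^ 2) ^ 3 := by
    have key : ∀ p q s : ℝ, 0 ≤ p → 0 ≤ q → 0 ≤ s → 27 * (p * q * s) ≤ (p + q + s) ^ 3 := by
      intro p q s hp hq hs
      nlinarith [mul_nonneg hp (sq_nonneg (q - s)), mul_nonneg hq (sq_nonneg (p - s)),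
        mul_nonneg hs (sq_nonneg (p - q)), mul_nonneg (add_nonneg (add_nonneg hp hq) hs)
          (add_nonneg (add_nonneg (sq_nonneg (p - q)) (sq_nonneg (q - s))) (sq_nonneg (p - s)))]
    exact key _ _ _ (sq_nonneg a) (sq_nonneg b) (sq_nonneg c)
  have h9 : (a ^ 2 + b ^ 2 + c ^ 2) ^ 3 ≤ (9 * r ^ 2) ^ 3 := by gcongr
  have e : ((√3 * r) ^ 3) ^ 2 = 27 * r ^ 6 := by
    calc ((√3 * r) ^ 3) ^ 2 = (√3 ^ 2) ^ 3 * r ^ 6 := by ring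
      _ = _ := by rw [h3]; ring
  rw [e]
  nlinarith

/-- The primitive cube root of unity in the upper half plane. -/
noncomputable def cubeRoot : ℂ := ⟨-1 / 2, √3 / 2⟩

theorem cubeRoot_sq : cubeRoot ^ 2 = -1 - cubeRoot := by
  have h3 : √3 * √3 = (3 : ℝ) := Real.mul_self_sqrt (by norm_num)
  rw [sq]
  apply Complex.ext <;> simp [cubeRoot] <;> nlinarith

theorem cubeRoot_pow_three : cubeRoot ^ 3 = 1 := by
  rw [pow_succ, cubeRoot_sq]
  linear_combination -cubeRoot_sq

theorem norm_cubeRoot : ‖cubeRoot‖ = 1 := by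
  have h : ‖cubeRoot‖ ^ 3 = 1 := by rw [← norm_pow, cubeRoot_pow_three, norm_one]
  exact (pow_eq_one_iff_of_nonneg (norm_nonneg _) (by norm_num)).mp h

theorem norm_cubeRoot_sq_sub : ‖cubeRoot ^ 2 - cubeRoot‖ = √3 := by
  have h3 : √3 ^ 2 = (3 : ℝ) := Real.sq_sqrt (by norm_num)
  have : cubeRoot ^ 2 - cubeRoot = (-√3 : ℝ) * Complex.I := by
    rw [cubeRoot_sq]
    apply Complex.ext <;> simp [cubeRoot] <;> ring
  rw [this, norm_mul, Complex.norm_I, mul_one, Complex.norm_real, norm_neg,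
    Real.norm_of_nonneg (Real.sqrt_nonneg 3)]

/-- The Vandermonde product of three points. -/
def vdm (x y z : ℂ) : ℂ := (y - x) * (z - x) * (z - y)

theorem norm_vdm_le {x y z : ℂ} (hx : ‖x‖ ≤ 1) (hy : ‖y‖ ≤ 1) (hz : ‖z‖ ≤ 1) :
    ‖vdm x y z‖ ≤ √3 ^ 3 := by
  rw [vdm, norm_mul, norm_mul]
  simpa using norm_sub_mul_norm_sub_mul_norm_sub_le hx hy hz

theorem vdm_cubeRoot (x : ℂ) :
    vdm x cubeRoot (cubeRoot ^ 2) = (x ^ 2 + x + 1) * (cubeRoot ^ 2 - cubeRoot) := by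
  rw [vdm, cubeRoot_sq]
  linear_combination (1 + 2 * cubeRoot) * cubeRoot_sq

theorem norm_vdm_cubeRoot_one : ‖vdm 1 cubeRoot (cubeRoot ^ 2)‖ = √3 ^ 3 := by
  have h3 : √3 ^ 2 = (3 : ℝ) := Real.sq_sqrt (by norm_num)
  rw [vdm_cubeRoot, norm_mul, norm_cubeRoot_sq_sub, pow_succ √3 2, h3]
  norm_num

theorem vdm_swap (x y z : ℂ) : vdm x z y = -vdm x y z := by
  rw [vdm, vdm]; ring

/-- The defect is quadratic: the product equals `√3 |1 + 2 cos t|`, and `cos t ≥ 1 - t²/2`. -/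
theorem norm_vdm_exp_cubeRoot (t : ℝ) :
    √3 ^ 3 - ‖vdm (Complex.exp (t * Complex.I)) cubeRoot (cubeRoot ^ 2)‖ ≤ √3 * t ^ 2 := by
  have h3 : √3 ^ 2 = (3 : ℝ) := Real.sq_sqrt (by norm_num)
  have e : Complex.exp (t * Complex.I) ^ 2 + Complex.exp (t * Complex.I) + 1
      = Complex.exp (t * Complex.I) * ((1 + 2 * Real.cos t : ℝ) : ℂ) := by
    push_cast
    rw [Complex.cos]
    have : Complex.exp (t * Complex.I) * Complex.exp (-t * Complex.I) = 1 := by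
      rw [← Complex.exp_add]; simp
    linear_combination -this
  rw [vdm_cubeRoot, norm_mul, norm_cubeRoot_sq_sub, e, norm_mul, Complex.norm_exp_ofReal_mul_I,
    one_mul, Complex.norm_real, pow_succ, h3]
  have h1 : 1 + 2 * Real.cos t ≤ ‖1 + 2 * Real.cos t‖ := le_abs_self _
  have h2 := Real.one_sub_sq_div_two_le_cos (x := t)
  have h4 : 0 ≤ √3 := Real.sqrt_nonneg 3
  nlinarith

/-! ### First-order variation at equilateral triangles -/

theorem eq_zero_of_hasDerivAt_of_norm_le_sq {p : ℝ → ℂ} {d : ℂ} {C : ℝ} (hd : HasDerivAt p d 0)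
    (h : ∀ t : ℝ, t ≠ 0 → |t| ≤ 1 → ‖p t‖ ≤ C * t ^ 2) : d = 0 := by
  have hev : ∀ᶠ t : ℝ in 𝓝[≠] 0, t ≠ 0 ∧ |t| ≤ 1 := by
    refine Filter.Eventually.and self_mem_nhdsWithin (nhdsWithin_le_nhds ?_)
    filter_upwards [Metric.ball_mem_nhds (0 : ℝ) one_pos] with t ht
    have : |t| < 1 := by simpa using ht
    exact this.le
  have hp0 : p 0 = 0 := by
    have h1 : Filter.Tendsto p (𝓝[≠] 0) (𝓝 (p 0)) :=
      hd.continuousAt.tendsto.mono_left nhdsWithin_le_nhds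
    have h2 : Filter.Tendsto p (𝓝[≠] 0) (𝓝 0) := by
      refine squeeze_zero_norm' (hev.mono fun t ht => h t ht.1 ht.2) ?_
      refine Filter.Tendsto.mono_left ?_ nhdsWithin_le_nhds
      simpa using (Continuous.tendsto (by fun_prop : Continuous fun t : ℝ => C * t ^ 2) 0)
    exact tendsto_nhds_unique h1 h2
  refine tendsto_nhds_unique (hasDerivAt_iff_tendsto_slope.mp hd) ?_
  refine squeeze_zero_norm' (a := fun t => C * |t|) (hev.mono fun t ht => ?_) ?_
  · rw [slope_def_module, hp0, sub_zero, sub_zero, norm_smul, norm_inv, Real.norm_eq_abs]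
    have ht0 : 0 < |t| := abs_pos.mpr ht.1
    rw [inv_mul_le_iff₀ ht0]
    refine (h t ht.1 ht.2).trans (le_of_eq ?_)
    rw [← sq_abs]; ring
  · refine Filter.Tendsto.mono_left ?_ nhdsWithin_le_nhds
    simpa using (Continuous.tendsto (by fun_prop : Continuous fun t : ℝ => C * |t|) 0)

/-- The quotient `(x ^ m - y ^ m) / (x - y)` as a polynomial in `x` and `y`. -/
def geomQuot (m : ℕ) (x y : ℂ) : ℂ := ∑ i ∈ Finset.range m, x ^ i * y ^ (m - 1 - i)

theorem geomQuot_comm (m : ℕ) (x y : ℂ) : geomQuot m x y = geomQuot m y x := by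
  unfold geomQuot
  rw [← Finset.sum_range_reflect]
  refine Finset.sum_congr rfl fun i hi => ?_
  rw [Finset.mem_range] at hi
  rw [mul_comm, show m - 1 - (m - 1 - i) = i by lia]

theorem sub_mul_geomQuot (m : ℕ) (x y : ℂ) : (y - x) * geomQuot m x y = y ^ m - x ^ m := by
  rw [geomQuot_comm, geomQuot, mul_comm, geom_sum₂_mul]

theorem hasDerivAt_geomQuot (m : ℕ) (x y : ℂ) :
    HasDerivAt (fun x => geomQuot m x y)
      (∑ i ∈ Finset.range m, (i * x ^ (i - 1)) * y ^ (m - 1 - i)) x := by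
  unfold geomQuot
  exact HasDerivAt.fun_sum fun i _ => (hasDerivAt_pow i x).mul_const _

theorem cubeRoot_pow_add (k : ℕ) : cubeRoot ^ k + (cubeRoot ^ 2) ^ k
    = if k % 3 = 0 then 2 else -1 := by
  have h4 : cubeRoot ^ 4 = cubeRoot := by rw [pow_succ, cubeRoot_pow_three, one_mul]
  obtain ⟨n, hn⟩ : ∃ n, k = 3 * n + k % 3 := ⟨k / 3, by lia⟩
  have hlt : k % 3 < 3 := Nat.mod_lt _ (by norm_num)
  rw [← pow_mul]
  generalize hj : k % 3 = j at *
  subst hn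
  have e1 : cubeRoot ^ (3 * n + j) = cubeRoot ^ j := by
    rw [pow_add, pow_mul, cubeRoot_pow_three, one_pow, one_mul]
  have e2 : cubeRoot ^ (2 * (3 * n + j)) = cubeRoot ^ (2 * j) := by
    rw [mul_add, pow_add, ← mul_assoc, mul_comm 2 3, mul_assoc, pow_mul, cubeRoot_pow_three,
      one_pow, one_mul]
  rw [e1, e2]
  interval_cases j
  · norm_num
  · simp [cubeRoot_sq]
  · norm_num [h4, cubeRoot_sq]

theorem sum_cubeRoot_eq (m : ℕ) :
    ∑ i ∈ Finset.range m, (cubeRoot ^ (m - 1 - i) + (cubeRoot ^ 2) ^ (m - 1 - i))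
      = ((if m % 3 = 0 then 0 else if m % 3 = 1 then 2 else 1 : ℕ) : ℂ) := by
  rw [Finset.sum_range_reflect (fun k => cubeRoot ^ k + (cubeRoot ^ 2) ^ k)]
  induction m with
  | zero => simp
  | succ m ih =>
    rw [Finset.sum_range_succ, ih, cubeRoot_pow_add]
    have hlt : m % 3 < 3 := Nat.mod_lt _ (by norm_num)
    have : m % 3 = 0 ∨ m % 3 = 1 ∨ m % 3 = 2 := by lia
    rcases this with h | h | h <;> (simp [h, Nat.add_mod]; try norm_num)

/-- Raising `m` by one adds the sum of `sum_cubeRoot_eq`, which runs through `0, 2, 1` periodically,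
so the total is positive from `m = 2` on. -/
theorem exists_sum_mul_cubeRoot_eq (m : ℕ) : ∃ N : ℕ,
    ∑ i ∈ Finset.range m, (i : ℂ) * (cubeRoot ^ (m - 1 - i) + (cubeRoot ^ 2) ^ (m - 1 - i)) = N ∧
      (2 ≤ m → 0 < N) := by
  induction m with
  | zero => exact ⟨0, by simp⟩
  | succ m ih =>
    obtain ⟨N, hN, hpos⟩ := ih
    refine ⟨N + (if m % 3 = 0 then 0 else if m % 3 = 1 then 2 else 1), ?_, fun hm => ?_⟩
    · rw [Nat.cast_add, ← sum_cubeRoot_eq, ← hN, Finset.sum_range_succ', ← Finset.sum_add_distrib]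
      simp only [Nat.cast_zero, zero_mul, add_zero]
      refine Finset.sum_congr rfl fun i _ => ?_
      rw [show m + 1 - 1 - (i + 1) = m - 1 - i by lia]
      push_cast
      ring
    · rcases Nat.lt_or_ge m 2 with h | h
      · have : m = 1 := by lia
        subst this
        norm_num
      · exact Nat.add_pos_left (hpos h) _

/-- Second order control near the equilateral triangles forces `A + B = 0`. -/
theorem add_eq_zero_of_vdm_bound {m : ℕ} (hm : 2 ≤ m) {A B C : ℂ} {K : ℝ}
    (H : ∀ x y z : ℂ, ‖x‖ = 1 → ‖y‖ = 1 → ‖z‖ = 1 → ∀ δ : ℝ, 0 < δ → √3 ^ 3 - ‖vdm x y z‖ ≤ δ →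
      ‖vdm x y z * (geomQuot m x y * A + geomQuot m x z * B + geomQuot m y z * C)‖ ≤ K * δ) :
    A + B = 0 := by
  set w := cubeRoot with hw
  have hw1 : ‖w‖ = 1 := norm_cubeRoot
  have hw2 : ‖w ^ 2‖ = 1 := by rw [norm_pow, hw1, one_pow]
  have h3 : √3 ^ 2 = (3 : ℝ) := Real.sq_sqrt (by norm_num)
  have h31 : 1 ≤ √3 := Real.one_le_sqrt.mpr (by norm_num)
  have hS : ∀ y z : ℂ, ‖y‖ = 1 → ‖z‖ = 1 →
      (∀ x, ‖vdm x y z‖ = ‖vdm x w (w ^ 2)‖) → ∀ t : ℝ, t ≠ 0 → |t| ≤ 1 →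
      ‖geomQuot m (Complex.exp (t * Complex.I)) y * A
        + geomQuot m (Complex.exp (t * Complex.I)) z * B + geomQuot m y z * C‖
        ≤ K * √3 * t ^ 2 := by
    intro y z hy hz hyz t ht0 ht1
    have hδ := norm_vdm_exp_cubeRoot t
    rw [← hyz] at hδ
    have hx := Complex.norm_exp_ofReal_mul_I t
    have := H _ y z hx hy hz (√3 * t ^ 2) (by positivity) hδ
    rw [norm_mul] at this
    have ht2 : t ^ 2 ≤ 1 := by rw [← sq_abs]; exact pow_le_one₀ (abs_nonneg t) ht1
    -- For `|t| ≤ 1` the product is at least `3√3 - √3 ≥ 1`, so it can be dropped from the bound.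
    have hD : 1 ≤ ‖vdm (Complex.exp (t * Complex.I)) y z‖ := by
      rw [pow_succ, h3] at hδ
      nlinarith
    have := le_mul_of_one_le_left (norm_nonneg (geomQuot m (Complex.exp (t * Complex.I)) y * A
        + geomQuot m (Complex.exp (t * Complex.I)) z * B + geomQuot m y z * C)) hD
    linarith
  have hexp : HasDerivAt (fun t : ℝ => Complex.exp (t * Complex.I)) Complex.I 0 := by
    have h1 : HasDerivAt (fun t : ℝ => (t : ℂ) * Complex.I) Complex.I 0 := by
      simpa using (Complex.ofRealCLM.hasDerivAt (x := (0 : ℝ))).mul_const Complex.I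
    simpa using h1.cexp
  have hQ : ∀ y : ℂ, HasDerivAt (fun t : ℝ => geomQuot m (Complex.exp (t * Complex.I)) y)
      ((∑ i ∈ Finset.range m, (i : ℂ) * y ^ (m - 1 - i)) * Complex.I) 0 := by
    intro y
    have h1 := hasDerivAt_geomQuot m (Complex.exp ((0 : ℝ) * Complex.I)) y
    have h2 := h1.scomp (0 : ℝ) hexp
    refine HasDerivAt.congr_deriv (f := fun t : ℝ => geomQuot m (Complex.exp (t * Complex.I)) y)
      h2 ?_
    simp [mul_comm]
  have hφ := (((hQ w).mul_const A).add ((hQ (w ^ 2)).mul_const B)).add_const (geomQuot m w (w ^ 2) * C)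
  have hψ := (((hQ (w ^ 2)).mul_const A).add ((hQ w).mul_const B)).add_const
    (geomQuot m (w ^ 2) w * C)
  have h0 := eq_zero_of_hasDerivAt_of_norm_le_sq hφ (C := K * √3) fun t ht0 ht1 =>
    hS w (w ^ 2) hw1 hw2 (fun _ => rfl) t ht0 ht1
  -- Adding the relation with the two cube roots exchanged makes the coefficients of `A` and `B`
  -- equal.
  have h0' := eq_zero_of_hasDerivAt_of_norm_le_sq hψ (C := K * √3) fun t ht0 ht1 =>
    hS (w ^ 2) w hw2 hw1 (fun x => by rw [vdm_swap, norm_neg]) t ht0 ht1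
  obtain ⟨N, hN, hpos⟩ := exists_sum_mul_cubeRoot_eq m
  simp only [mul_add, Finset.sum_add_distrib] at hN
  have hprod : (N : ℂ) * (A + B) * Complex.I = 0 := by
    rw [← hN]
    linear_combination h0 + h0'
  have hN0 : (N : ℂ) ≠ 0 := by exact_mod_cast (hpos hm).ne'
  have := (mul_eq_zero.mp hprod).resolve_right Complex.I_ne_zero
  exact (mul_eq_zero.mp this).resolve_left hN0

/-- Permuting the points changes the Vandermonde product only by a sign and permutes `A`, `B`, `C`,
so all pairwise sums vanish. -/
theorem eq_zero_of_vdm_bound {m : ℕ} (hm : 2 ≤ m) {A B C : ℂ} {K : ℝ}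
    (H : ∀ x y z : ℂ, ‖x‖ = 1 → ‖y‖ = 1 → ‖z‖ = 1 → ∀ δ : ℝ, 0 < δ → √3 ^ 3 - ‖vdm x y z‖ ≤ δ →
      ‖vdm x y z * (geomQuot m x y * A + geomQuot m x z * B + geomQuot m y z * C)‖ ≤ K * δ) :
    A = 0 := by
  have h1 : A + B = 0 := add_eq_zero_of_vdm_bound hm H
  have h2 : A + C = 0 := by
    refine add_eq_zero_of_vdm_bound (C := B) (K := K) hm fun x y z hx hy hz δ hδ h => ?_
    have e : ‖vdm y x z‖ = ‖vdm x y z‖ := by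
      rw [show vdm y x z = -vdm x y z by rw [vdm, vdm]; ring, norm_neg]
    have := H y x z hy hx hz δ hδ (by rwa [e])
    rw [norm_mul, e, geomQuot_comm m y x] at this
    rw [norm_mul]
    convert this using 3
    ring
  have h3 : C + B = 0 := by
    refine add_eq_zero_of_vdm_bound (C := A) (K := K) hm fun x y z hx hy hz δ hδ h => ?_
    have e : ‖vdm z y x‖ = ‖vdm x y z‖ := by
      rw [show vdm z y x = -vdm x y z by rw [vdm, vdm]; ring, norm_neg]
    have := H z y x hz hy hx δ hδ (by rwa [e])
    rw [norm_mul, e, geomQuot_comm m z y, geomQuot_comm m z x, geomQuot_comm m y x] at this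
    rw [norm_mul]
    convert this using 3
    ring
  linear_combination (h1 + h2 - h3) / 2

/-! ### The `3`-diameter of a ball -/

theorem rpow_one_third_pow {x : ℝ} (hx : 0 ≤ x) : (x ^ (1 / 3 : ℝ)) ^ 3 = x := by
  rw [← Real.rpow_natCast, ← Real.rpow_mul hx]
  norm_num

theorem pow_rpow_one_third {x : ℝ} (hx : 0 ≤ x) : (x ^ 3) ^ (1 / 3 : ℝ) = x := by
  rw [← Real.rpow_natCast, ← Real.rpow_mul hx]
  norm_num

theorem nDiam_three_eq (E : Set ℍ) : nDiam 3 E = sSup {d : ℝ | ∃ w : Fin 3 → ℍ, (∀ i, w i ∈ E) ∧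
    d = (‖w 1 - w 0‖ * ‖w 2 - w 0‖ * ‖w 2 - w 1‖) ^ (1 / 3 : ℝ)} := by
  have h0 : Finset.Ioi (0 : Fin 3) = {1, 2} := by decide
  have h1 : Finset.Ioi (1 : Fin 3) = {2} := by decide
  have h2 : Finset.Ioi (2 : Fin 3) = ∅ := by decide
  have e : (2 : ℝ) / ((3 : ℕ) * ((3 : ℕ) - 1)) = 1 / 3 := by norm_num
  unfold nDiam
  simp only [Fin.prod_univ_three, h0, h1, h2, e, Finset.prod_pair (show (1 : Fin 3) ≠ 2 by decide),
    Finset.prod_singleton, Finset.prod_empty, mul_one]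

theorem nDiam_three_ball {r : ℝ} (hr : 0 < r) : nDiam 3 (Metric.ball 0 r) = √3 * r := by
  rw [nDiam_three_eq]
  refine csSup_eq_of_forall_le_of_forall_lt_exists_gt ?_ ?_ ?_
  · exact ⟨_, fun _ => 0, fun _ => Metric.mem_ball_self hr, rfl⟩
  · rintro d ⟨w, hw, rfl⟩
    have hn : ∀ i, ‖w i‖ ≤ r := fun i => (by simpa using hw i : ‖w i‖ < r).le
    have := norm_sub_mul_norm_sub_mul_norm_sub_le (hn 0) (hn 1) (hn 2)
    rw [← pow_rpow_one_third (by positivity : 0 ≤ √3 * r)]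
    exact Real.rpow_le_rpow (by positivity) this (by norm_num)
  · intro b hb
    have h3 : 0 < √3 := Real.sqrt_pos.mpr (by norm_num)
    -- The ball is open, so the supremum is only approached, by equilateral triangles of
    -- circumradius `s < r`.
    obtain ⟨s, hs1, hs2⟩ : ∃ s, max (b / √3) 0 < s ∧ s < r :=
      exists_between (max_lt ((div_lt_iff₀ h3).mpr (by linarith)) hr)
    have hs0 : 0 < s := (le_max_right _ _).trans_lt hs1
    obtain ⟨I, hI⟩ := exists_mem_imagUnits
    have hmul : ∀ x y : ℂ, ‖slicePoint I (s * x) - slicePoint I (s * y)‖ = s * ‖x - y‖ := by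
      intro x y
      rw [← slicePoint_sub hI, norm_slicePoint hI, ← mul_sub, norm_mul, Complex.norm_real,
        Real.norm_of_nonneg hs0.le]
    refine ⟨_, ⟨![slicePoint I (s * 1), slicePoint I (s * cubeRoot),
      slicePoint I (s * cubeRoot ^ 2)], ?_, rfl⟩, ?_⟩
    · intro i
      fin_cases i <;> simp [norm_slicePoint hI, norm_cubeRoot, abs_of_pos hs0, hs2]
    · have e := norm_vdm_cubeRoot_one
      rw [vdm, norm_mul, norm_mul] at e
      simp only [Matrix.cons_val_zero, Matrix.cons_val_one, Matrix.cons_val, hmul]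
      rw [show s * ‖cubeRoot - 1‖ * (s * ‖cubeRoot ^ 2 - 1‖) * (s * ‖cubeRoot ^ 2 - cubeRoot‖)
        = s ^ 3 * (‖cubeRoot - 1‖ * ‖cubeRoot ^ 2 - 1‖ * ‖cubeRoot ^ 2 - cubeRoot‖) by ring, e,
        ← mul_pow, pow_rpow_one_third (by positivity)]
      have := (le_max_left _ _).trans_lt hs1
      rwa [div_lt_iff₀ h3] at this

/-! ### Projections onto the planes `L_J` -/

/-- The projection of `ℍ` onto `L_J`, as a complex number. -/
noncomputable def sliceProj (J : ℍ) : ℍ →L[ℝ] ℂ :=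
  LinearMap.toContinuousLinearMap
    { toFun := fun q => ⟨q.re, -(J * q).re⟩
      map_add' := fun p q => by
        apply Complex.ext
        · simp
        · simp [mul_add]; ring
      map_smul' := fun x q => by
        apply Complex.ext
        · simp
        · simp; ring }

theorem sliceProj_apply (J q : ℍ) : sliceProj J q = ⟨q.re, -(J * q).re⟩ := rfl

theorem sliceProj_mul {J : ℍ} (hJ : J ∈ imagUnits) (z : ℂ) (q : ℍ) :
    sliceProj J (slicePoint J z * q) = z * sliceProj J q := by
  have h2 : J * J = -1 := by rw [← sq]; exact hJ
  have e : J * (slicePoint J z * q) = z.re • (J * q) - z.im • q := by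
    rw [slicePoint, add_mul, mul_add, Quaternion.coe_mul_eq_smul, Quaternion.coe_mul_eq_smul,
      smul_mul_assoc, mul_smul_comm, mul_smul_comm, ← mul_assoc, h2, neg_one_mul, smul_neg,
      sub_eq_add_neg]
  have e' : slicePoint J z * q = z.re • q + z.im • (J * q) := by
    rw [slicePoint, add_mul, Quaternion.coe_mul_eq_smul, Quaternion.coe_mul_eq_smul,
      smul_mul_assoc]
  rw [sliceProj_apply, sliceProj_apply, e, e']
  apply Complex.ext
  · simp only [Quaternion.re_add, Quaternion.re_smul, smul_eq_mul, Complex.mul_re]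
    ring
  · simp only [Quaternion.re_sub, Quaternion.re_smul, smul_eq_mul, Complex.mul_im]
    ring

theorem sliceProj_ofReal {J : ℍ} (hJ : J ∈ imagUnits) (x : ℝ) : sliceProj J (x : ℍ) = x := by
  rw [sliceProj_apply, ← Quaternion.coe_commutes, Quaternion.coe_mul_eq_smul]
  apply Complex.ext
  · simp
  · simp [re_eq_zero_of_mem_imagUnits hJ]

theorem abs_re_le_norm (q : ℍ) : |q.re| ≤ ‖q‖ := by
  refine abs_le_of_sq_le_sq ?_ (norm_nonneg q)
  rw [sq ‖q‖, ← Quaternion.normSq_eq_norm_mul_self, Quaternion.normSq_def']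
  nlinarith [sq_nonneg q.imI, sq_nonneg q.imJ, sq_nonneg q.imK]

theorem norm_sliceProj_le {J : ℍ} (hJ : J ∈ imagUnits) (q : ℍ) : ‖sliceProj J q‖ ≤ ‖q‖ := by
  -- Multiplying `q` on the left by the conjugate of its projection `p` gives real part `‖p‖²`,
  -- which is at most `‖p‖ ‖q‖`.
  have h1 := sliceProj_mul hJ ((starRingEnd ℂ) (sliceProj J q)) q
  rw [Complex.conj_mul'] at h1
  have h2 := congrArg Complex.re h1
  have h3 := abs_re_le_norm (slicePoint J ((starRingEnd ℂ) (sliceProj J q)) * q)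
  rw [norm_mul, norm_slicePoint hJ, RCLike.norm_conj] at h3
  have h4 : (sliceProj J (slicePoint J ((starRingEnd ℂ) (sliceProj J q)) * q)).re
      = (slicePoint J ((starRingEnd ℂ) (sliceProj J q)) * q).re := rfl
  rw [h4, ← Complex.ofReal_pow, Complex.ofReal_re] at h2
  rw [h2, abs_of_nonneg (sq_nonneg _), sq] at h3
  rcases (norm_nonneg (sliceProj J q)).eq_or_lt with h | h
  · rw [← h]; exact norm_nonneg q
  · exact le_of_mul_le_mul_left h3 h

theorem exists_sliceProj_mul_eq_norm {J : ℍ} (hJ : J ∈ imagUnits) (q : ℍ) :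
    ∃ v : ℍ, ‖v‖ = 1 ∧ sliceProj J (q * v) = ‖q‖ := by
  by_cases hq : q = 0
  · exact ⟨1, norm_one, by simp [hq]⟩
  · have hn : ‖q‖ ≠ 0 := norm_ne_zero_iff.mpr hq
    refine ⟨q⁻¹ * (‖q‖ : ℝ), ?_, ?_⟩
    · rw [norm_mul, norm_inv, Quaternion.norm_coe, norm_norm, inv_mul_cancel₀ hn]
    · rw [← mul_assoc, mul_inv_cancel₀ hq, one_mul, sliceProj_ofReal hJ]

theorem re_sliceProj (J q : ℍ) : (sliceProj J q).re = q.re := rfl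

theorem im_sliceProj (J q : ℍ) : (sliceProj J q).im
    = J.imI * q.imI + J.imJ * q.imJ + J.imK * q.imK - J.re * q.re := by
  rw [sliceProj_apply, Quaternion.re_mul]
  ring

theorem eq_zero_of_forall_sliceProj {q : ℍ} (h : ∀ J ∈ imagUnits, sliceProj J q = 0) : q = 0 := by
  have him : ∀ J ∈ imagUnits, J.imI * q.imI + J.imJ * q.imJ + J.imK * q.imK - J.re * q.re = 0 :=
    fun J hJ => by rw [← im_sliceProj, h J hJ, Complex.zero_im]
  have h1 := him (⟨0, 1, 0, 0⟩ : ℍ) (mem_imagUnits_of_sq_add_sq rfl (by norm_num))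
  have h2 := him (⟨0, 0, 1, 0⟩ : ℍ) (mem_imagUnits_of_sq_add_sq rfl (by norm_num))
  have h3 := him (⟨0, 0, 0, 1⟩ : ℍ) (mem_imagUnits_of_sq_add_sq rfl (by norm_num))
  obtain ⟨I, hI⟩ := exists_mem_imagUnits
  have h0 : q.re = 0 := by rw [← re_sliceProj I, h I hI, Complex.zero_re]
  ext
  · exact h0
  · simpa using h1
  · simpa using h2
  · simpa using h3

/-! ### The power series `ĝ` -/

theorem mem_closedDisc_iff {I : ℍ} (hI : I ∈ imagUnits) {r : ℝ} {q : ℍ} :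
    q ∈ closedDisc I r ↔ ∃ z : ℂ, ‖z‖ ≤ r ∧ q = slicePoint I z := by
  constructor
  · rintro ⟨h1, z, rfl⟩
    refine ⟨z, ?_, rfl⟩
    simpa [norm_slicePoint hI] using h1
  · rintro ⟨z, hz, rfl⟩
    exact ⟨by simpa [norm_slicePoint hI] using hz, z, rfl⟩

/-- The summands of the coefficients of `ĝ`. -/
noncomputable def gHatTerm (f : ℍ → ℍ) (w₁ w₂ w₃ : ℍ) (i j l : ℕ) : ℍ :=
  (w₂ ^ i - w₁ ^ i) * (w₃ ^ j - w₁ ^ j) * (w₃ ^ l - w₂ ^ l)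
    * normCoeff f i * normCoeff f j * normCoeff f l

/-- The coefficients of the power series `ĝ`. -/
noncomputable def gHatCoeff (f : ℍ → ℍ) (w₁ w₂ w₃ : ℍ) (n : ℕ) : ℍ :=
  ∑ k ∈ Finset.range (n + 1), ∑ j ∈ Finset.range (k + 1), gHatTerm f w₁ w₂ w₃ j (k - j) (n - k)

theorem gHat_eq (f : ℍ → ℍ) (w₁ w₂ w₃ z : ℍ) :
    gHat f w₁ w₂ w₃ z = ∑' n : ℕ, z ^ n * gHatCoeff f w₁ w₂ w₃ n := rfl

section Terms

variable (f : ℍ → ℍ) (w₁ w₂ w₃ : ℍ)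

theorem gHatTerm_zero_left (j l : ℕ) : gHatTerm f w₁ w₂ w₃ 0 j l = 0 := by simp [gHatTerm]

theorem gHatTerm_zero_mid (i l : ℕ) : gHatTerm f w₁ w₂ w₃ i 0 l = 0 := by simp [gHatTerm]

theorem gHatTerm_zero_right (i j : ℕ) : gHatTerm f w₁ w₂ w₃ i j 0 = 0 := by simp [gHatTerm]

/-- Three indices with sum below 3 include a zero, and its difference of zeroth powers vanishes. -/
theorem gHatCoeff_of_lt_three {n : ℕ} (hn : n < 3) : gHatCoeff f w₁ w₂ w₃ n = 0 := by
  refine Finset.sum_eq_zero fun k hk => Finset.sum_eq_zero fun j hj => ?_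
  rw [Finset.mem_range] at hk hj
  have : j = 0 ∨ k - j = 0 ∨ n - k = 0 := by lia
  rcases this with h | h | h <;> rw [h]
  · exact gHatTerm_zero_left ..
  · exact gHatTerm_zero_mid ..
  · exact gHatTerm_zero_right ..

theorem gHatCoeff_three : gHatCoeff f w₁ w₂ w₃ 3 = gHatTerm f w₁ w₂ w₃ 1 1 1 := by
  simp [gHatCoeff, Finset.sum_range_succ, gHatTerm_zero_left, gHatTerm_zero_mid,
    gHatTerm_zero_right]

/-- Surviving indices are `1` or at least `m`; three of them with sum `m + 2` can only be `m, 1, 1`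
in some order. -/
theorem gHatCoeff_add_two {m : ℕ} (hm : 2 ≤ m)
    (h : ∀ n, 2 ≤ n → n < m → normCoeff f n = 0) :
    gHatCoeff f w₁ w₂ w₃ (m + 2) = gHatTerm f w₁ w₂ w₃ m 1 1 + gHatTerm f w₁ w₂ w₃ 1 m 1
      + gHatTerm f w₁ w₂ w₃ 1 1 m := by
  have hl : ∀ i j l, (i = 0 ∨ 2 ≤ i ∧ i < m) ∨ (j = 0 ∨ 2 ≤ j ∧ j < m) ∨ (l = 0 ∨ 2 ≤ l ∧ l < m) →
      gHatTerm f w₁ w₂ w₃ i j l = 0 := by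
    intro i j l hijl
    rcases hijl with (rfl | hi) | (rfl | hi) | (rfl | hi)
    · exact gHatTerm_zero_left ..
    · simp [gHatTerm, h i hi.1 hi.2]
    · exact gHatTerm_zero_mid ..
    · simp [gHatTerm, h j hi.1 hi.2]
    · exact gHatTerm_zero_right ..
    · simp [gHatTerm, h l hi.1 hi.2]
  rw [gHatCoeff, ← Finset.sum_subset (s₁ := {m + 1, 2}), Finset.sum_pair (by lia),
    ← Finset.sum_subset (s₁ := {m, 1}), Finset.sum_pair (by lia),
    ← Finset.sum_subset (s₁ := {1}) (s₂ := Finset.range (2 + 1)), Finset.sum_singleton]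
  · rw [show m + 1 - m = 1 by lia, show m + 2 - (m + 1) = 1 by lia, show m + 1 - 1 = m by lia,
      show m + 2 - 2 = m by lia]
  · intro j hj
    simp only [Finset.mem_singleton, Finset.mem_range] at hj ⊢
    lia
  · intro j hj hj'
    simp only [Finset.mem_singleton, Finset.mem_range] at hj hj'
    exact hl _ _ _ (by lia)
  · intro j hj
    simp only [Finset.mem_insert, Finset.mem_singleton, Finset.mem_range] at hj ⊢
    lia
  · intro j hj hj'
    simp only [Finset.mem_insert, Finset.mem_singleton, Finset.mem_range] at hj hj'
    exact hl _ _ _ (by lia)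
  · intro j hj
    simp only [Finset.mem_insert, Finset.mem_singleton, Finset.mem_range] at hj ⊢
    lia
  · intro k hk hk'
    simp only [Finset.mem_insert, Finset.mem_singleton, Finset.mem_range] at hk hk'
    refine Finset.sum_eq_zero fun j hj => hl _ _ _ ?_
    rw [Finset.mem_range] at hj
    lia

end Terms

/-- A bound for the coefficients of `ĝ`, uniform in `w₁, w₂, w₃`. -/
noncomputable def gHatBound (f : ℍ → ℍ) (n : ℕ) : ℝ :=
  ∑ k ∈ Finset.range (n + 1), ∑ j ∈ Finset.range (k + 1),
    8 * (‖coeff f j‖ * ‖coeff f (k - j)‖ * ‖coeff f (n - k)‖)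

theorem gHatBound_nonneg (f : ℍ → ℍ) (n : ℕ) : 0 ≤ gHatBound f n := by
  unfold gHatBound; positivity

theorem norm_pow_sub_pow_le_two {v w : ℍ} (hv : ‖v‖ ≤ 1) (hw : ‖w‖ ≤ 1) (n : ℕ) :
    ‖v ^ n - w ^ n‖ ≤ 2 := by
  refine (norm_sub_le _ _).trans ?_
  rw [norm_pow, norm_pow]
  linarith [pow_le_one₀ (norm_nonneg v) hv (n := n), pow_le_one₀ (norm_nonneg w) hw (n := n)]

theorem norm_gHatCoeff_le (f : ℍ → ℍ) {w₁ w₂ w₃ : ℍ} (h₁ : ‖w₁‖ ≤ 1) (h₂ : ‖w₂‖ ≤ 1)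
    (h₃ : ‖w₃‖ ≤ 1) (n : ℕ) : ‖gHatCoeff f w₁ w₂ w₃ n‖ ≤ gHatBound f n := by
  refine norm_sum_le_of_le _ fun k _ => norm_sum_le_of_le _ fun j _ => ?_
  rw [gHatTerm]
  simp only [norm_mul, norm_normCoeff]
  calc _ ≤ 2 * 2 * 2 * ‖coeff f j‖ * ‖coeff f (k - j)‖ * ‖coeff f (n - k)‖ := by
        gcongr <;> exact norm_pow_sub_pow_le_two ‹_› ‹_› _
    _ = _ := by ring

/-- Up to the factor 8 this is a threefold Cauchy product of `∑ ‖a_n‖ r ^ n`. -/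
theorem summable_gHatBound {f : ℍ → ℍ} (hf : IsSliceRegular 1 f) {r : ℝ} (hr : 0 ≤ r)
    (hr1 : r < 1) : Summable fun n => gHatBound f n * r ^ n := by
  have h := summable_norm_coeff hf hr hr1
  have hn : Summable fun n => ‖‖coeff f n‖ * r ^ n‖ := h.norm
  have h2 := summable_norm_sum_mul_range_of_summable_norm hn hn
  have h3 := (summable_norm_sum_mul_range_of_summable_norm h2.norm.of_norm hn).of_norm
  refine (h3.mul_left 8).congr fun n => ?_
  rw [gHatBound, Finset.mul_sum, Finset.sum_mul]
  refine Finset.sum_congr rfl fun k hk => ?_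
  rw [Finset.sum_mul, Finset.sum_mul, Finset.mul_sum]
  refine Finset.sum_congr rfl fun j hj => ?_
  rw [Finset.mem_range] at hk hj
  have e : r ^ n = r ^ j * r ^ (k - j) * r ^ (n - k) := by
    rw [← pow_add, ← pow_add]; congr 1; lia
  rw [e]; ring

theorem summable_gHatBound_shift {f : ℍ → ℍ} (hf : IsSliceRegular 1 f) {r : ℝ} (hr : 0 ≤ r)
    (hr1 : r < 1) : Summable fun n => gHatBound f (n + 3) * r ^ n := by
  -- The larger radius `s` is positive, so `s ^ 3` can be divided out even when `r = 0`.
  obtain ⟨s, hrs, hs1⟩ := exists_between hr1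
  have hs0 : 0 < s := hr.trans_lt hrs
  have h := ((summable_nat_add_iff 3).mpr (summable_gHatBound hf hs0.le hs1)).mul_right (s ^ 3)⁻¹
  refine Summable.of_nonneg_of_le
    (fun n => mul_nonneg (gHatBound_nonneg f _) (pow_nonneg hr n)) (fun n => ?_) h
  rw [pow_add, ← mul_assoc, mul_inv_cancel_right₀ (by positivity)]
  have := gHatBound_nonneg f (n + 3)
  gcongr

theorem hasSum_gHat {f : ℍ → ℍ} (hf : IsSliceRegular 1 f) {w₁ w₂ w₃ z : ℍ} (h₁ : ‖w₁‖ ≤ 1)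
    (h₂ : ‖w₂‖ ≤ 1) (h₃ : ‖w₃‖ ≤ 1) (hz : ‖z‖ < 1) :
    HasSum (fun n => z ^ n * gHatCoeff f w₁ w₂ w₃ n) (gHat f w₁ w₂ w₃ z) := by
  rw [gHat_eq]
  refine Summable.hasSum ?_
  refine Summable.of_norm_bounded (summable_gHatBound hf (norm_nonneg z) hz) fun n => ?_
  rw [norm_mul, norm_pow, mul_comm]
  gcongr
  exact norm_gHatCoeff_le f h₁ h₂ h₃ n

theorem norm_gHat_le {f : ℍ → ℍ} (hf : IsSliceRegular 1 f) {w₁ w₂ w₃ z : ℍ} (h₁ : ‖w₁‖ ≤ 1)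
    (h₂ : ‖w₂‖ ≤ 1) (h₃ : ‖w₃‖ ≤ 1) {r : ℝ} (hz : ‖z‖ ≤ r) (hr1 : r < 1) :
    ‖gHat f w₁ w₂ w₃ z‖ ≤ ∑' n, gHatBound f n * r ^ n := by
  have hr : 0 ≤ r := (norm_nonneg z).trans hz
  rw [gHat_eq]
  refine tsum_of_norm_bounded (summable_gHatBound hf hr hr1).hasSum fun n => ?_
  rw [norm_mul, norm_pow, mul_comm]
  have := gHatBound_nonneg f n
  gcongr
  exact norm_gHatCoeff_le f h₁ h₂ h₃ n

/-- On each slice, every projection of `ĝ` is `z ^ 3` times a holomorphic function. -/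
theorem exists_hasSum_sliceProj_gHat {f : ℍ → ℍ} (hf : IsSliceRegular 1 f) {w₁ w₂ w₃ : ℍ}
    (h₁ : ‖w₁‖ ≤ 1) (h₂ : ‖w₂‖ ≤ 1) (h₃ : ‖w₃‖ ≤ 1) {J : ℍ} (hJ : J ∈ imagUnits) (v : ℍ) :
    ∃ u : ℂ → ℂ,
      (∀ z : ℂ, ‖z‖ < 1 →
        HasSum (fun n => z ^ n • sliceProj J (gHatCoeff f w₁ w₂ w₃ (n + 3) * v)) (u z)) ∧
      ∀ z : ℂ, ‖z‖ < 1 → sliceProj J (gHat f w₁ w₂ w₃ (slicePoint J z) * v) = z ^ 3 * u z := by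
  have hs : ∀ z : ℂ, ‖z‖ < 1 →
      Summable fun n => z ^ n • sliceProj J (gHatCoeff f w₁ w₂ w₃ (n + 3) * v) := by
    intro z hz
    refine Summable.of_norm_bounded
      ((summable_gHatBound_shift hf (norm_nonneg z) hz).mul_right ‖v‖) fun n => ?_
    rw [norm_smul, norm_pow, mul_comm, mul_right_comm]
    gcongr
    refine (norm_sliceProj_le hJ _).trans ?_
    rw [norm_mul]
    gcongr
    exact norm_gHatCoeff_le f h₁ h₂ h₃ _
  refine ⟨_, fun z hz => (hs z hz).hasSum, fun z hz => ?_⟩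
  have hz' : ‖slicePoint J z‖ < 1 := by rwa [norm_slicePoint hJ]
  have h := ((hasSum_gHat hf h₁ h₂ h₃ hz').mul_right v).mapL (sliceProj J)
  refine h.unique ?_
  rw [← hasSum_nat_add_iff' 3]
  have e : ∀ n, sliceProj J (slicePoint J z ^ n * gHatCoeff f w₁ w₂ w₃ n * v)
      = z ^ n * sliceProj J (gHatCoeff f w₁ w₂ w₃ n * v) := fun n => by
    rw [mul_assoc, ← slicePoint_pow hJ, sliceProj_mul hJ]
  simp only [e]
  rw [Finset.sum_eq_zero (fun i hi => by
    rw [gHatCoeff_of_lt_three f w₁ w₂ w₃ (by simpa using hi), zero_mul, map_zero, mul_zero]),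
    sub_zero]
  refine ((hs z hz).hasSum.mul_left (z ^ 3)).congr_fun fun n => ?_
  rw [smul_eq_mul, pow_add]
  ring

theorem gHatTerm_slicePoint (f : ℍ → ℍ) {I : ℍ} (hI : I ∈ imagUnits) (x y z : ℂ) (i j l : ℕ) :
    gHatTerm f (slicePoint I x) (slicePoint I y) (slicePoint I z) i j l
      = slicePoint I ((y ^ i - x ^ i) * (z ^ j - x ^ j) * (z ^ l - y ^ l))
        * (normCoeff f i * normCoeff f j * normCoeff f l) := by
  simp only [gHatTerm, slicePoint_mul hI, slicePoint_sub hI, slicePoint_pow hI, mul_assoc]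

theorem gHatCoeff_three_slicePoint (f : ℍ → ℍ) {I : ℍ} (hI : I ∈ imagUnits) (x y z : ℂ) :
    gHatCoeff f (slicePoint I x) (slicePoint I y) (slicePoint I z) 3
      = slicePoint I (vdm x y z) * (normCoeff f 1 * normCoeff f 1 * normCoeff f 1) := by
  rw [gHatCoeff_three, gHatTerm_slicePoint f hI]
  simp only [pow_one, vdm]

theorem norm_gHatCoeff_three_slicePoint (f : ℍ → ℍ) {I : ℍ} (hI : I ∈ imagUnits) (x y z : ℂ) :
    ‖gHatCoeff f (slicePoint I x) (slicePoint I y) (slicePoint I z) 3‖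
      = ‖vdm x y z‖ * ‖normCoeff f 1‖ ^ 3 := by
  rw [gHatCoeff_three_slicePoint f hI, norm_mul, norm_slicePoint hI, norm_mul, norm_mul]
  ring

/-! ### The slice `3`-diameter and the inequalities -/

/-- The properties of the range of the variable of `ĝ` shared by the discs `r𝔹_I` and the
balls `r𝔹`. -/
structure IsSliceDomain (Z : ℍ → ℝ → Set ℍ) : Prop where
  closedDisc_subset : ∀ I r, closedDisc I r ⊆ Z I r
  exists_slice : ∀ I ∈ imagUnits, ∀ r, ∀ q ∈ Z I r, ∃ J ∈ imagUnits, ∃ ζ : ℂ, ‖ζ‖ ≤ r ∧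
    q = slicePoint J ζ ∧ ∀ ρ, ∀ ξ : ℂ, ‖ξ‖ ≤ ρ → slicePoint J ξ ∈ Z I ρ

theorem isSliceDomain_closedDisc : IsSliceDomain closedDisc where
  closedDisc_subset _ _ := subset_rfl
  exists_slice I hI r q hq := by
    obtain ⟨ζ, hζ, rfl⟩ := (mem_closedDisc_iff hI).mp hq
    exact ⟨I, hI, ζ, hζ, rfl, fun ρ ξ hξ => (mem_closedDisc_iff hI).mpr ⟨ξ, hξ, rfl⟩⟩

theorem isSliceDomain_closedBall : IsSliceDomain fun _ r => Metric.closedBall 0 r where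
  closedDisc_subset _ _ := Set.inter_subset_left
  exists_slice I hI r q hq := by
    obtain ⟨J, hJ, ζ, rfl⟩ := exists_slicePoint_eq q
    refine ⟨J, hJ, ζ, by simpa [norm_slicePoint hJ] using hq, rfl, fun ρ ξ hξ => ?_⟩
    simpa [norm_slicePoint hJ] using hξ

section SliceDiam

variable {Z : ℍ → ℝ → Set ℍ} {f : ℍ → ℍ}

theorem norm_le_of_mem_closedDisc {I w : ℍ} {r : ℝ} (hw : w ∈ closedDisc I r) : ‖w‖ ≤ r := by
  simpa using hw.1

theorem sliceDiam3_nonneg (Z : ℍ → ℝ → Set ℍ) (f : ℍ → ℍ) (r : ℝ) : 0 ≤ sliceDiam3 Z f r := by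
  refine Real.sSup_nonneg ?_
  rintro d ⟨I, -, w₁, -, w₂, -, w₃, -, z, -, rfl⟩
  positivity

theorem norm_gHat_le_sliceDiam3 (hZ : IsSliceDomain Z) (hf : IsSliceRegular 1 f) {r : ℝ}
    (hr1 : r < 1) {I : ℍ} (hI : I ∈ imagUnits) {w₁ w₂ w₃ z : ℍ} (h₁ : w₁ ∈ closedDisc I 1)
    (h₂ : w₂ ∈ closedDisc I 1) (h₃ : w₃ ∈ closedDisc I 1) (hz : z ∈ Z I r) :
    ‖gHat f w₁ w₂ w₃ z‖ ≤ sliceDiam3 Z f r ^ 3 := by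
  have hbdd : BddAbove {d : ℝ | ∃ I ∈ imagUnits, ∃ w₁ ∈ closedDisc I 1, ∃ w₂ ∈ closedDisc I 1,
      ∃ w₃ ∈ closedDisc I 1, ∃ z ∈ Z I r, d = ‖gHat f w₁ w₂ w₃ z‖ ^ (1 / 3 : ℝ)} := by
    refine ⟨(∑' n, gHatBound f n * r ^ n) ^ (1 / 3 : ℝ), ?_⟩
    rintro d ⟨I, hI, w₁, h₁, w₂, h₂, w₃, h₃, z, hz, rfl⟩
    obtain ⟨J, hJ, ζ, hζ, rfl, -⟩ := hZ.exists_slice I hI r z hz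
    refine Real.rpow_le_rpow (norm_nonneg _) ?_ (by norm_num)
    exact norm_gHat_le hf (norm_le_of_mem_closedDisc h₁) (norm_le_of_mem_closedDisc h₂)
      (norm_le_of_mem_closedDisc h₃) (by rwa [norm_slicePoint hJ]) hr1
  rw [← rpow_one_third_pow (norm_nonneg (gHat f w₁ w₂ w₃ z))]
  gcongr
  exact le_csSup hbdd ⟨I, hI, w₁, h₁, w₂, h₂, w₃, h₃, z, hz, rfl⟩

theorem sliceDiam3_le {r K : ℝ} (hK : 0 ≤ K)
    (h : ∀ I ∈ imagUnits, ∀ w₁ ∈ closedDisc I 1, ∀ w₂ ∈ closedDisc I 1, ∀ w₃ ∈ closedDisc I 1,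
      ∀ z ∈ Z I r, ‖gHat f w₁ w₂ w₃ z‖ ≤ K) : sliceDiam3 Z f r ≤ K ^ (1 / 3 : ℝ) := by
  refine Real.sSup_le ?_ (by positivity)
  rintro d ⟨I, hI, w₁, h₁, w₂, h₂, w₃, h₃, z, hz, rfl⟩
  exact Real.rpow_le_rpow (norm_nonneg _) (h I hI w₁ h₁ w₂ h₂ w₃ h₃ z hz) (by norm_num)

/-- Maximum modulus principle for the projections of `ĝ / z ^ 3`. -/
theorem norm_le_sliceDiam3_div (hZ : IsSliceDomain Z) (hf : IsSliceRegular 1 f) {I J : ℍ}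
    (hI : I ∈ imagUnits) (hJ : J ∈ imagUnits) (hJZ : ∀ ρ, ∀ ξ : ℂ, ‖ξ‖ ≤ ρ → slicePoint J ξ ∈ Z I ρ)
    {w₁ w₂ w₃ v : ℍ} (h₁ : w₁ ∈ closedDisc I 1) (h₂ : w₂ ∈ closedDisc I 1)
    (h₃ : w₃ ∈ closedDisc I 1) (hv : ‖v‖ = 1) {u : ℂ → ℂ}
    (hu : ∀ z : ℂ, ‖z‖ < 1 →
        HasSum (fun n => z ^ n • sliceProj J (gHatCoeff f w₁ w₂ w₃ (n + 3) * v)) (u z))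
    (hug : ∀ z : ℂ, ‖z‖ < 1 → sliceProj J (gHat f w₁ w₂ w₃ (slicePoint J z) * v) = z ^ 3 * u z)
    {ρ : ℝ} (hρ : 0 < ρ) (hρ1 : ρ < 1) {z : ℂ} (hz : ‖z‖ ≤ ρ) :
    ‖u z‖ ≤ sliceDiam3 Z f ρ ^ 3 / ρ ^ 3 := by
  refine norm_mul_le_of_sphere hu hρ hρ1 (fun ξ hξ => ?_) hz
  rw [← hug ξ (by rwa [hξ])]
  refine (norm_sliceProj_le hJ _).trans ?_
  rw [norm_mul, hv, mul_one]
  exact norm_gHat_le_sliceDiam3 hZ hf hρ1 hI h₁ h₂ h₃ (hJZ ρ ξ hξ.le)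

/-- If the slice `3`-diameter tends to `√3`, the projections of `ĝ / z ^ 3` are bounded by
`√3 ^ 3` on the unit disc. -/
theorem norm_le_of_tendsto (hZ : IsSliceDomain Z) (hf : IsSliceRegular 1 f)
    (hd : Filter.Tendsto (fun r : ℝ => sliceDiam3 Z f r) (𝓝[<] 1) (𝓝 √3)) {I J : ℍ}
    (hI : I ∈ imagUnits) (hJ : J ∈ imagUnits) (hJZ : ∀ ρ, ∀ ξ : ℂ, ‖ξ‖ ≤ ρ → slicePoint J ξ ∈ Z I ρ)
    {w₁ w₂ w₃ v : ℍ} (h₁ : w₁ ∈ closedDisc I 1) (h₂ : w₂ ∈ closedDisc I 1)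
    (h₃ : w₃ ∈ closedDisc I 1) (hv : ‖v‖ = 1) {u : ℂ → ℂ}
    (hu : ∀ z : ℂ, ‖z‖ < 1 →
        HasSum (fun n => z ^ n • sliceProj J (gHatCoeff f w₁ w₂ w₃ (n + 3) * v)) (u z))
    (hug : ∀ z : ℂ, ‖z‖ < 1 → sliceProj J (gHat f w₁ w₂ w₃ (slicePoint J z) * v) = z ^ 3 * u z)
    (z : ℂ) (hz : ‖z‖ < 1) : ‖u z‖ ≤ √3 ^ 3 := by
  have hid : Filter.Tendsto (fun ρ : ℝ => ρ) (𝓝[<] 1) (𝓝 1) := nhdsWithin_le_nhds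
  have hlim : Filter.Tendsto (fun ρ : ℝ => sliceDiam3 Z f ρ ^ 3 / ρ ^ 3) (𝓝[<] 1)
      (𝓝 (√3 ^ 3 / 1 ^ 3)) := (hd.pow 3).div (hid.pow 3) (by norm_num)
  rw [one_pow, div_one] at hlim
  refine ge_of_tendsto hlim ?_
  filter_upwards [Ioo_mem_nhdsLT hz] with ρ hρ
  exact norm_le_sliceDiam3_div hZ hf hI hJ hJZ h₁ h₂ h₃ hv hu hug
    ((norm_nonneg z).trans_lt hρ.1) hρ.2 hρ.1.le

theorem slicePoint_mem_of_norm_le (hZ : IsSliceDomain Z) {I : ℍ} (hI : I ∈ imagUnits) (ρ : ℝ)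
    (ξ : ℂ) (hξ : ‖ξ‖ ≤ ρ) : slicePoint I ξ ∈ Z I ρ :=
  hZ.closedDisc_subset I ρ ((mem_closedDisc_iff hI).mpr ⟨ξ, hξ, rfl⟩)

/-- No limit hypothesis is needed here. The bound gives (2) as `r → 1`, and equality in (1) when
`|a₁| = 1`. -/
theorem sqrt_three_mul_le_sliceDiam3 (hZ : IsSliceDomain Z) (hf : IsSliceRegular 1 f) {r : ℝ}
    (hr : 0 < r) (hr1 : r < 1) : √3 * ‖coeff f 1‖ * r ≤ sliceDiam3 Z f r := by
  obtain ⟨I, hI⟩ := exists_mem_imagUnits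
  have hmem : ∀ x : ℂ, ‖x‖ ≤ 1 → slicePoint I x ∈ closedDisc I 1 := fun x hx =>
    (mem_closedDisc_iff hI).mpr ⟨x, hx, rfl⟩
  have m₁ := hmem 1 (by simp)
  have m₂ := hmem cubeRoot norm_cubeRoot.le
  have m₃ := hmem (cubeRoot ^ 2) (by rw [norm_pow, norm_cubeRoot, one_pow])
  obtain ⟨v, hv, hvn⟩ := exists_sliceProj_mul_eq_norm hI
    (gHatCoeff f (slicePoint I 1) (slicePoint I cubeRoot) (slicePoint I (cubeRoot ^ 2)) 3)
  obtain ⟨u, hu, hug⟩ := exists_hasSum_sliceProj_gHat hf (norm_le_of_mem_closedDisc m₁)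
    (norm_le_of_mem_closedDisc m₂) (norm_le_of_mem_closedDisc m₃) hI v
  have h := norm_le_sliceDiam3_div hZ hf hI hI (slicePoint_mem_of_norm_le hZ hI) m₁ m₂ m₃ hv hu hug
    hr hr1 (z := 0) (by simpa using hr.le)
  rw [apply_zero_of_hasSum hu, zero_add, hvn, Complex.norm_real, norm_norm,
    norm_gHatCoeff_three_slicePoint f hI, norm_vdm_cubeRoot_one, norm_normCoeff,
    le_div_iff₀ (by positivity), ← mul_pow, ← mul_pow] at h
  exact le_of_pow_le_pow_left₀ three_ne_zero (sliceDiam3_nonneg Z f r) h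

theorem norm_coeff_one_le (hZ : IsSliceDomain Z) (hf : IsSliceRegular 1 f)
    (hd : Filter.Tendsto (fun r : ℝ => sliceDiam3 Z f r) (𝓝[<] 1) (𝓝 √3)) : ‖coeff f 1‖ ≤ 1 := by
  have hid : Filter.Tendsto (fun ρ : ℝ => √3 * ‖coeff f 1‖ * ρ) (𝓝[<] 1)
      (𝓝 (√3 * ‖coeff f 1‖ * 1)) :=
    (Continuous.tendsto (by fun_prop) 1).mono_left nhdsWithin_le_nhds
  have h := le_of_tendsto_of_tendsto hid hd (by
    filter_upwards [Ioo_mem_nhdsLT (zero_lt_one (α := ℝ))] with ρ hρ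
    exact sqrt_three_mul_le_sliceDiam3 hZ hf hρ.1 hρ.2)
  have h3 : 0 < √3 := Real.sqrt_pos.mpr (by norm_num)
  rw [mul_one] at h
  exact le_of_mul_le_mul_left (by simpa using h) h3

theorem sliceDiam3_le_sqrt_three_mul (hZ : IsSliceDomain Z) (hf : IsSliceRegular 1 f)
    (hd : Filter.Tendsto (fun r : ℝ => sliceDiam3 Z f r) (𝓝[<] 1) (𝓝 √3)) {r : ℝ} (hr : 0 < r)
    (hr1 : r < 1) : sliceDiam3 Z f r ≤ √3 * r := by
  rw [← pow_rpow_one_third (by positivity : 0 ≤ √3 * r)]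
  refine sliceDiam3_le (by positivity) fun I hI w₁ h₁ w₂ h₂ w₃ h₃ z hz => ?_
  obtain ⟨J, hJ, ζ, hζ, rfl, hJZ⟩ := hZ.exists_slice I hI r z hz
  obtain ⟨v, hv, hvn⟩ := exists_sliceProj_mul_eq_norm hJ (gHat f w₁ w₂ w₃ (slicePoint J ζ))
  obtain ⟨u, hu, hug⟩ := exists_hasSum_sliceProj_gHat hf (norm_le_of_mem_closedDisc h₁)
    (norm_le_of_mem_closedDisc h₂) (norm_le_of_mem_closedDisc h₃) hJ v
  have hζ1 := hζ.trans_lt hr1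
  have h := norm_le_of_tendsto hZ hf hd hI hJ hJZ h₁ h₂ h₃ hv hu hug ζ hζ1
  have e := congrArg norm (hug ζ hζ1)
  rw [hvn, Complex.norm_real, norm_norm, norm_mul, norm_pow] at e
  rw [e, mul_pow, mul_comm]
  gcongr

theorem sliceDiam3_lt_of_norm_coeff_one_lt (hZ : IsSliceDomain Z) (hf : IsSliceRegular 1 f)
    (hd : Filter.Tendsto (fun r : ℝ => sliceDiam3 Z f r) (𝓝[<] 1) (𝓝 √3)) {r : ℝ} (hr : 0 < r)
    (hr1 : r < 1) (hlt : ‖coeff f 1‖ < 1) : sliceDiam3 Z f r < √3 * r := by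
  have h3 : 0 < √3 := Real.sqrt_pos.mpr (by norm_num)
  set s := ‖coeff f 1‖ ^ 3 with hs
  have hs0 : 0 ≤ s := by positivity
  have hs1 : s < 1 := pow_lt_one₀ (norm_nonneg _) hlt three_ne_zero
  have hM : 0 < √3 ^ 3 := by positivity
  have hr' : 0 < 1 - r := by linarith
  have hs' : 0 < 1 - s := by linarith
  -- This is the bound of `norm_le_sub_of_norm_le` with `‖c 0‖` replaced by `√3 ^ 3 * s`, which
  -- dominates it for all `w`'s.
  set K := √3 ^ 3 - (√3 ^ 3 - √3 ^ 3 * s) * (1 - r) / (1 + r) with hK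
  have hKlt : K < √3 ^ 3 := by
    have : 0 < (√3 ^ 3 - √3 ^ 3 * s) * (1 - r) / (1 + r) := by
      rw [← mul_one_sub]; positivity
    linarith
  have hK0 : 0 ≤ K := by
    have h1 : (√3 ^ 3 - √3 ^ 3 * s) * (1 - r) / (1 + r) ≤ √3 ^ 3 * 1 / 1 := by
      gcongr
      · nlinarith
      · linarith
      · linarith
    linarith
  refine (sliceDiam3_le (K := r ^ 3 * K) (by positivity)
    fun I hI w₁ h₁ w₂ h₂ w₃ h₃ z hz => ?_).trans_lt ?_
  · obtain ⟨J, hJ, ζ, hζ, rfl, hJZ⟩ := hZ.exists_slice I hI r z hz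
    obtain ⟨v, hv, hvn⟩ := exists_sliceProj_mul_eq_norm hJ (gHat f w₁ w₂ w₃ (slicePoint J ζ))
    obtain ⟨u, hu, hug⟩ := exists_hasSum_sliceProj_gHat hf (norm_le_of_mem_closedDisc h₁)
      (norm_le_of_mem_closedDisc h₂) (norm_le_of_mem_closedDisc h₃) hJ v
    have hζ1 := hζ.trans_lt hr1
    have hb := norm_le_of_tendsto hZ hf hd hI hJ hJZ h₁ h₂ h₃ hv hu hug
    have hc : ‖sliceProj J (gHatCoeff f w₁ w₂ w₃ (0 + 3) * v)‖ ≤ √3 ^ 3 * s := by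
      refine (norm_sliceProj_le hJ _).trans ?_
      obtain ⟨x, hx, rfl⟩ := (mem_closedDisc_iff hI).mp h₁
      obtain ⟨y, hy, rfl⟩ := (mem_closedDisc_iff hI).mp h₂
      obtain ⟨t, ht, rfl⟩ := (mem_closedDisc_iff hI).mp h₃
      rw [norm_mul, hv, mul_one, zero_add, norm_gHatCoeff_three_slicePoint f hI, norm_normCoeff]
      gcongr
      exact norm_vdm_le hx hy ht
    have h := norm_le_sub_of_norm_le hu hb (hc.trans_lt (by nlinarith)) hr1 hζ
    have hle : ‖u ζ‖ ≤ K := by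
      refine h.trans ?_
      rw [hK]
      gcongr
    have e := congrArg norm (hug ζ hζ1)
    rw [hvn, Complex.norm_real, norm_norm, norm_mul, norm_pow] at e
    rw [e]
    gcongr
  · rw [← pow_rpow_one_third (by positivity : 0 ≤ √3 * r)]
    refine Real.rpow_lt_rpow (by positivity) ?_ (by norm_num)
    rw [mul_pow, mul_comm]
    gcongr

/-! ### Rigidity and the equality cases -/

theorem normCoeff_eq_zero_of_norm_coeff_one (hZ : IsSliceDomain Z) (hf : IsSliceRegular 1 f)
    (hd : Filter.Tendsto (fun r : ℝ => sliceDiam3 Z f r) (𝓝[<] 1) (𝓝 √3))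
    (h1 : ‖coeff f 1‖ = 1) {m : ℕ} (hm : 2 ≤ m) : normCoeff f m = 0 := by
  induction m using Nat.strong_induction_on with
  | _ m ih =>
  set b := normCoeff f 1 with hb
  have hb1 : ‖b‖ = 1 := by rw [hb, norm_normCoeff, h1]
  have hb0 : b ≠ 0 := norm_ne_zero_iff.mp (by rw [hb1]; exact one_ne_zero)
  have hb3 : b * b * b ≠ 0 := mul_ne_zero (mul_ne_zero hb0 hb0) hb0
  -- With this `v` the constant term of `u` is exactly the Vandermonde product of the three points.
  set v := (b * b * b)⁻¹ with hv
  have hv1 : ‖v‖ = 1 := by rw [hv, norm_inv, norm_mul, norm_mul, hb1]; norm_num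
  have key : normCoeff f m * b * b * v = 0 := by
    refine eq_zero_of_forall_sliceProj fun I hI => ?_
    refine eq_zero_of_vdm_bound hm (B := sliceProj I (b * normCoeff f m * b * v))
      (C := sliceProj I (b * b * normCoeff f m * v)) (K := 2 ^ (m - 1 + 1))
      fun x y z hx hy hz δ hδ hδ' => ?_
    have m₁ := (mem_closedDisc_iff hI).mpr ⟨x, hx.le, rfl⟩
    have m₂ := (mem_closedDisc_iff hI).mpr ⟨y, hy.le, rfl⟩
    have m₃ := (mem_closedDisc_iff hI).mpr ⟨z, hz.le, rfl⟩
    obtain ⟨u, hu, hug⟩ := exists_hasSum_sliceProj_gHat hf (norm_le_of_mem_closedDisc m₁)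
      (norm_le_of_mem_closedDisc m₂) (norm_le_of_mem_closedDisc m₃) hI v
    have hbd := norm_le_of_tendsto hZ hf hd hI hI (slicePoint_mem_of_norm_le hZ hI) m₁ m₂ m₃ hv1
      hu hug
    have hc0 : sliceProj I (gHatCoeff f (slicePoint I x) (slicePoint I y) (slicePoint I z) (0 + 3)
        * v) = vdm x y z := by
      rw [zero_add, gHatCoeff_three_slicePoint f hI, mul_assoc, ← hb, hv, mul_inv_cancel₀ hb3,
        sliceProj_mul hI]
      have := sliceProj_ofReal hI 1
      rw [Quaternion.coe_one, Complex.ofReal_one] at this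
      rw [this, mul_one]
    -- Division by `z³` shifts indices by 3: the coefficient `m - 1` of `u` is the coefficient `m +
    -- 2` of `ĝ`.
    have h := norm_coeff_le_of_norm_le hu hbd hδ (by rwa [hc0]) (k := m - 1) (by lia)
    rw [show m - 1 + 3 = m + 2 by lia, gHatCoeff_add_two f _ _ _ hm fun n hn hnm => ih n hnm hn,
      gHatTerm_slicePoint f hI, gHatTerm_slicePoint f hI, gHatTerm_slicePoint f hI, ← hb, add_mul,
      add_mul, map_add, map_add, mul_assoc (slicePoint I _), mul_assoc (slicePoint I _),
      mul_assoc (slicePoint I _), sliceProj_mul hI, sliceProj_mul hI, sliceProj_mul hI,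
      ← sub_mul_geomQuot m x y, ← sub_mul_geomQuot m x z, ← sub_mul_geomQuot m y z] at h
    convert h using 2
    simp only [pow_one, vdm]
    ring
  have := (mul_eq_zero.mp key).resolve_right (inv_ne_zero hb3)
  exact (mul_eq_zero.mp ((mul_eq_zero.mp this).resolve_right hb0)).resolve_right hb0

theorem isUnitAffine_iff (hZ : IsSliceDomain Z) (hf : IsSliceRegular 1 f)
    (hd : Filter.Tendsto (fun r : ℝ => sliceDiam3 Z f r) (𝓝[<] 1) (𝓝 √3)) :
    ‖coeff f 1‖ = 1 ↔ IsUnitAffine f := by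
  constructor
  · intro h
    refine ⟨coeff f 0, coeff f 1, h, fun q hq => ?_⟩
    refine eq_affine_of_coeff_eq_zero hf (fun n hn => ?_) q (by simpa using hq)
    rw [← norm_eq_zero, ← norm_normCoeff, normCoeff_eq_zero_of_norm_coeff_one hZ hf hd h hn,
      norm_zero]
  · rintro ⟨a, b, hb, hab⟩
    rw [← sliceDeriv_zero, coeff_one_of_affine hab, hb]

theorem exists_sliceDiam3_eq_iff (hZ : IsSliceDomain Z) (hf : IsSliceRegular 1 f)
    (hd : Filter.Tendsto (fun r : ℝ => sliceDiam3 Z f r) (𝓝[<] 1) (𝓝 √3)) :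
    (∃ r ∈ Set.Ioo (0 : ℝ) 1, sliceDiam3 Z f r = √3 * r) ↔ ‖coeff f 1‖ = 1 := by
  constructor
  · rintro ⟨r, hr, h⟩
    refine le_antisymm (norm_coeff_one_le hZ hf hd) (not_lt.mp fun hlt => ?_)
    exact (sliceDiam3_lt_of_norm_coeff_one_lt hZ hf hd hr.1 hr.2 hlt).ne h
  · intro h
    -- Any radius in `(0, 1)` would do.
    refine ⟨1 / 2, ⟨by norm_num, by norm_num⟩, le_antisymm
      (sliceDiam3_le_sqrt_three_mul hZ hf hd (by norm_num) (by norm_num)) ?_⟩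
    simpa [h] using sqrt_three_mul_le_sliceDiam3 hZ hf (r := 1 / 2) (by norm_num) (by norm_num)

end SliceDiam

end SliceRegular

theorem mainTheorem3 (f : ℍ → ℍ) (hf : SliceRegular.IsSliceRegular 1 f)
    (Z : ℍ → ℝ → Set ℍ)
    (hZ : Z = SliceRegular.closedDisc ∨ Z = fun _ r => Metric.closedBall 0 r)
    (hd : Filter.Tendsto (fun r : ℝ => SliceRegular.sliceDiam3 Z f r) (𝓝[<] 1)
      (𝓝 (SliceRegular.nDiam 3 (Metric.ball 0 1)))) :
    SliceRegular.nDiam 3 (Metric.ball 0 1) = √3 ∧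
    (∀ r ∈ Set.Ioo (0 : ℝ) 1,
      SliceRegular.sliceDiam3 Z f r ≤ SliceRegular.nDiam 3 (Metric.ball 0 r)) ∧
    ‖SliceRegular.sliceDeriv f 0‖ ≤ 1 ∧
    ((∃ r ∈ Set.Ioo (0 : ℝ) 1,
      SliceRegular.sliceDiam3 Z f r = SliceRegular.nDiam 3 (Metric.ball 0 r)) ↔
        SliceRegular.IsUnitAffine f) ∧
    (‖SliceRegular.sliceDeriv f 0‖ = 1 ↔ SliceRegular.IsUnitAffine f) := by
  have hZ' : SliceRegular.IsSliceDomain Z := by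
    rcases hZ with rfl | rfl
    · exact SliceRegular.isSliceDomain_closedDisc
    · exact SliceRegular.isSliceDomain_closedBall
  have hn : SliceRegular.nDiam 3 (Metric.ball 0 1) = √3 := by
    rw [SliceRegular.nDiam_three_ball one_pos, mul_one]
  rw [hn] at hd
  have hiff := SliceRegular.isUnitAffine_iff hZ' hf hd
  rw [SliceRegular.sliceDeriv_zero]
  refine ⟨hn, fun r hr => ?_, SliceRegular.norm_coeff_one_le hZ' hf hd, ?_, hiff⟩
  · rw [SliceRegular.nDiam_three_ball hr.1]
    exact SliceRegular.sliceDiam3_le_sqrt_three_mul hZ' hf hd hr.1 hr.2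
  · rw [← hiff, ← SliceRegular.exists_sliceDiam3_eq_iff hZ' hf hd]
    refine exists_congr fun r => and_congr_right fun hr => ?_
    rw [SliceRegular.nDiam_three_ball hr.1]
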